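/- Let $\mathbb{T}^2=\mathbb{R}^2/\mathbb{Z}^2$, let $\delta>0$, let $B=H^{-1-\delta}(\mathbb{T}^2)$ be the Sobolev space of real distributions, and let $\mu$ be the law of white noise on $B$, i.e. the centered Gaussian measure with $\int_B\langle\omega,\phi\rangle\langle\omega,\psi\rangle\,\mu(d\omega)=\int_{\mathbb{T}^2}\phi\psi\,dx$ for all $\phi,\psi\in C^\infty(\mathbb{T}^2)$. For $g\in H^{2+r}(\mathbb{T}^2\times\mathbb{T}^2)$, $r>0$, let $\langle\omega\otimes\omega,g\rangle$ be the dual pairing, defined for $\mu$-a.e. $\omega$. For $f\in L^2(\mathbb{T}^2\times\mathbb{T}^2)$ and $c\in\mathbb{R}$, let $\langle\omega\otimes\omega,f\rangle_c$ be the limit in $L^2(B,\mu)$ of $\langle\omega\otimes\omega,f_k\rangle$, where the $f_k$ are continuous and of class $H^{2+}(\mathbb{T}^2\times\mathbb{T}^2)=\bigcup_{r>0}H^{2+r}(\mathbb{T}^2\times\mathbb{T}^2)$, $f_k\to f$ in $L^2(\mathbb{T}^2\times\mathbb{T}^2)$ and $\int_{\mathbb{T}^2}f_k(x,x)\,dx\to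 c$. The renormalized functional is $\langle\omega\otimes\omega,f\rangle:=\langle\omega\otimes\omega,f\rangle_0$; for continuous $f$ of class $H^{2+}$ the dual pairing is $\langle\omega\otimes\omega,f\rangle_c$ with $c=\int f(x,x)\,dx$. (a) Let $f:\mathbb{T}^2\times\mathbb{T}^2\to\mathbb{R}$ be bounded and measurable with $\|f\|_\infty\le1$, and let $c\in\mathbb{R}$. Then $\langle\omega\otimes\omega,f\rangle_c$ exists, is unique up to $\mu$-null sets, and $$\int_B e^{\epsilon|\langle\omega\otimes\omega,f\rangle_c|}\,\mu(d\omega)<\infty\qquad\text{for every }\epsilon<\tfrac12 .$$ (b) Let $K$ be the Biot–Savart kernel of $\mathbb{T}^2$, i.e. the integrable vector field of mean zero with $\operatorname{div}K=0$ and $\partial_2K_1-\partial_1K_2=\delta_0-1$ in the sense of distributions. Let $\phi\in C^\infty(\mathbb{T}^2)$ and $H_\phi(x,y)=\frac12K(x-y)\cdot(\nabla\phi(x)-\nabla\phi(y))$. Then $\langle b(\omega),\phi\rangle:=\langle\omega\otimes\omega,H_\phi\rangle_0$ exists, is unique up to $\mu$-null sets, and satisfies $\int_B e^{\epsilon|\langle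 b(\omega),\phi\rangle|}\,\mu(d\omega)<\infty$ for some $\epsilon>0$. More precisely, whenever $M\ge0$ is such that $|H_\phi|\le M$ almost everywhere, this integral is finite for every $\epsilon$ with $\epsilon M<\frac12$. -/

import Mathlib

open MeasureTheory ProbabilityTheory Filter Topology

noncomputable section

namespace Enstrophy

/-- The two-dimensional torus `ℝ² / ℤ²`. -/
abbrev T2 : Type := UnitAddTorus (Fin 2)

/-- The lattice `ℤ²` of frequencies. -/
abbrev Z2 : Type := Fin 2 → ℤ

/-- Lebesgue (= normalised Haar) measure on the torus, of total mass one. -/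
abbrev dx : Measure T2 := Measure.pi fun _ : Fin 2 => AddCircle.haarAddCircle

/-- Lebesgue measure on `T² × T²`. -/
abbrev dxdy : Measure (T2 × T2) := dx.prod dx

/-- `|n|²`, the squared Euclidean norm of a frequency. -/
def sqLen (n : Z2) : ℝ := (n 0 : ℝ) ^ 2 + (n 1 : ℝ) ^ 2

/-- The periodic function on `ℝ²` that corresponds to a function on the torus. -/
def lift (f : T2 → ℝ) (x : Fin 2 → ℝ) : ℝ := f fun i => (x i : UnitAddCircle)

/-- The space `C^∞(T²)` of smooth real functions on the torus. -/
def SmoothFun : Submodule ℝ (T2 → ℝ) where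
  carrier := {f | ContDiff ℝ (⊤ : ℕ∞) (lift f)}
  add_mem' {f g} (hf : ContDiff ℝ (⊤ : ℕ∞) (lift f)) (hg : ContDiff ℝ (⊤ : ℕ∞) (lift g)) :=
    hf.add hg
  zero_mem' := (contDiff_const : ContDiff ℝ (⊤ : ℕ∞) fun _ : Fin 2 → ℝ => (0 : ℝ))
  smul_mem' c {f} (hf : ContDiff ℝ (⊤ : ℕ∞) (lift f)) :=
    (contDiff_const (c := c)).mul hf

/-- The partial derivative `∂ᵢ f` of a function on the torus. -/
def pd (i : Fin 2) (f : T2 → ℝ) (x : T2) : ℝ :=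
  deriv (fun t : ℝ => f (x + Pi.single i (t : UnitAddCircle))) 0

/-- Real distributions on the torus: linear functionals on `C^∞(T²)` that are continuous, that is,
bounded by a constant times some `C^k` norm. -/
structure Distr where
  toFun : SmoothFun →ₗ[ℝ] ℝ
  cont : ∃ (k : ℕ) (C : ℝ), ∀ (φ : SmoothFun) (M : ℝ),
    (∀ j ≤ k, ∀ x, ‖iteratedFDeriv ℝ j (lift φ.1) x‖ ≤ M) → |toFun φ| ≤ C * M

theorem lift_mFourier (n : Z2) (x : Fin 2 → ℝ) :
    UnitAddTorus.mFourier n (fun i => (x i : UnitAddCircle)) =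
      ∏ i : Fin 2, Complex.exp (2 * Real.pi * Complex.I * n i * x i) := by
  simp only [UnitAddTorus.mFourier, ContinuousMap.coe_mk]
  refine Finset.prod_congr rfl fun i _ => ?_
  rw [fourier_coe_apply]
  simp

theorem contDiff_lift_mFourier (n : Z2) : ContDiff ℝ (⊤ : ℕ∞) fun x : Fin 2 → ℝ =>
    UnitAddTorus.mFourier n (fun i => (x i : UnitAddCircle)) := by
  simp only [lift_mFourier]
  refine contDiff_prod fun i _ => ContDiff.cexp (contDiff_const.mul ?_)
  exact Complex.ofRealCLM.contDiff.comp (contDiff_apply ℝ ℝ i)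

/-- `x ↦ cos (2π n·x)`. -/
def cosMode (n : Z2) : SmoothFun :=
  ⟨fun x => (UnitAddTorus.mFourier n x).re,
    Complex.reCLM.contDiff.comp (contDiff_lift_mFourier n)⟩

/-- `x ↦ sin (2π n·x)`. -/
def sinMode (n : Z2) : SmoothFun :=
  ⟨fun x => (UnitAddTorus.mFourier n x).im,
    Complex.imCLM.contDiff.comp (contDiff_lift_mFourier n)⟩

/-- The Fourier coefficient `⟨ω, eₙ⟩`, with `eₙ(x) = exp (2πi n·x)`, of a distribution `ω`
(extended to complex test functions by linearity). -/
def Distr.coeff (ω : Distr) (n : Z2) : ℂ :=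
  ⟨ω.toFun (cosMode n), ω.toFun (sinMode n)⟩

/-- The Sobolev space `H^s(T²)`. -/
def Sobolev (s : ℝ) : Type :=
  {ω : Distr // Summable fun n : Z2 => (1 + sqLen n) ^ s * ‖ω.coeff n‖ ^ 2}

/-- The duality `⟨ω, φ⟩`. -/
def Sobolev.pair {s : ℝ} (ω : Sobolev s) (φ : SmoothFun) : ℝ := ω.1.toFun φ

theorem Sobolev.memℓp {s : ℝ} (ω : Sobolev s) :
    Memℓp (fun n : Z2 => (((1 + sqLen n) ^ (s / 2) : ℝ) : ℂ) * ω.1.coeff n) 2 := by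
  refine memℓp_gen (ω.2.congr fun n => ?_)
  have h : (0 : ℝ) ≤ 1 + sqLen n := by unfold sqLen; positivity
  rw [norm_mul, Complex.norm_real, Real.norm_of_nonneg (Real.rpow_nonneg h _)]
  simp only [ENNReal.toReal_ofNat, Real.rpow_ofNat]
  rw [mul_pow, ← Real.rpow_natCast ((1 + sqLen n) ^ (s / 2)), ← Real.rpow_mul h]
  norm_num

/-- The sequence `(1 + |n|²)^{s/2} ⟨ω, eₙ⟩`, whose `ℓ²` norm is the `H^s` norm of `ω`. -/
def Sobolev.toL2 {s : ℝ} (ω : Sobolev s) : lp (fun _ : Z2 => ℂ) 2 :=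
  ⟨fun n : Z2 => (((1 + sqLen n) ^ (s / 2) : ℝ) : ℂ) * ω.1.coeff n, ω.memℓp⟩

/-- The topology of the norm of `H^s`. -/
instance (s : ℝ) : TopologicalSpace (Sobolev s) :=
  TopologicalSpace.induced Sobolev.toL2 inferInstance

instance (s : ℝ) : MeasurableSpace (Sobolev s) := borel _

instance (s : ℝ) : BorelSpace (Sobolev s) := ⟨rfl⟩

/-- `μ` is the law of white noise (the enstrophy measure): the centered Gaussian measure on
`H^s(T²)` with covariance the scalar product of `L²(T²)`. That is, every `⟨ω, φ⟩` is a centered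
Gaussian variable with variance `‖φ‖²` in `L²`; by linearity in `φ` this makes
`(⟨ω, φ⟩)_φ` a Gaussian family with covariance `E ⟨ω, φ⟩⟨ω, ψ⟩ = ∫ φ ψ`. -/
def IsWhiteNoise {s : ℝ} (μ : Measure (Sobolev s)) : Prop :=
  ∀ φ : SmoothFun,
    μ.map (fun ω => ω.pair φ) = gaussianReal 0 (Real.toNNReal (∫ x, φ.1 x ^ 2 ∂dx))

/-- The Fourier coefficient of `f` on `T² × T²` at the frequency `(n, m)`, so that
`f = ∑ coeff₂ f (n, m) eₙ ⊗ eₘ`. -/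
def coeff₂ (f : T2 × T2 → ℝ) (p : Z2 × Z2) : ℂ :=
  ∫ z, UnitAddTorus.mFourier (-p.1) z.1 * UnitAddTorus.mFourier (-p.2) z.2 * (f z : ℂ) ∂dxdy

/-- `f` is of class `H^{2+}(T² × T²)`: of class `H^{2+r}` for some `r > 0`. -/
def IsH2Plus (f : T2 × T2 → ℝ) : Prop :=
  ∃ r : ℝ, 0 < r ∧
    Summable fun p : Z2 × Z2 => (1 + sqLen p.1 + sqLen p.2) ^ (2 + r) * ‖coeff₂ f p‖ ^ 2

/-- The dual pairing `⟨ω ⊗ ω, f⟩` on `T² × T²` of the distribution `ω ⊗ ω`, whose coefficient at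
`eₙ ⊗ eₘ` is `⟨ω, eₙ⟩ ⟨ω, eₘ⟩`, with a function `f` of class `H^{2+}`. -/
def tensorPair {s : ℝ} (f : T2 × T2 → ℝ) (ω : Sobolev s) : ℝ :=
  (∑' p : Z2 × Z2, coeff₂ f p * (ω.1.coeff p.1 * ω.1.coeff p.2)).re

/-- The random variable `X` is `⟨ω ⊗ ω, f⟩` with diagonal part `c`: it is the limit in mean square
of `⟨ω ⊗ ω, fₖ⟩`, for continuous functions `fₖ` of class `H^{2+}` with `fₖ → f` in `L²(T² × T²)`
and `∫ fₖ(x, x) dx → c`. The renormalised functional is the one with `c = 0`; a continuous `f`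
of class `H^{2+}` itself has `X = ⟨ω ⊗ ω, f⟩` for `c = ∫ f(x, x) dx`. -/
def IsTensorLimit {s : ℝ} (μ : Measure (Sobolev s)) (f : T2 × T2 → ℝ) (c : ℝ)
    (X : Sobolev s → ℝ) : Prop :=
  MemLp X 2 μ ∧ ∃ F : ℕ → C(T2 × T2, ℝ),
    (∀ k, IsH2Plus (F k)) ∧
    Tendsto (fun k => eLpNorm (fun z => F k z - f z) 2 dxdy) atTop (𝓝 0) ∧
    Tendsto (fun k => ∫ x, F k (x, x) ∂dx) atTop (𝓝 c) ∧
    Tendsto (fun k => eLpNorm (fun ω => tensorPair (F k) ω - X ω) 2 μ) atTop (𝓝 0)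

/-- `K` is the Biot-Savart kernel of the torus, the kernel of the map `ω ↦ u = K ∗ ω` that inverts
`ω = ∂₂ u₁ - ∂₁ u₂` among divergence free fields of mean zero: the integrable vector field, unique
up to null sets, with `div K = 0`, `∂₂ K₁ - ∂₁ K₂ = δ₀ - 1` in the sense of distributions, and mean
zero (coordinates `1, 2` are indexed by `0, 1`). -/
structure IsBiotSavart (K : T2 → Fin 2 → ℝ) : Prop where
  integrable : ∀ i, Integrable (fun x => K x i) dx
  mean_zero : ∀ i, ∫ x, K x i ∂dx = 0
  div_eq : ∀ φ : SmoothFun, ∫ x, (K x 0 * pd 0 φ.1 x + K x 1 * pd 1 φ.1 x) ∂dx = 0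
  curl_eq : ∀ φ : SmoothFun,
    -∫ x, (K x 0 * pd 1 φ.1 x - K x 1 * pd 0 φ.1 x) ∂dx = φ.1 0 - ∫ x, φ.1 x ∂dx

/-- The symmetrised kernel `H_φ(x, y) = ½ K(x - y) · (∇φ(x) - ∇φ(y))` of the nonlinear term. -/
def kerH (K : T2 → Fin 2 → ℝ) (φ : T2 → ℝ) (z : T2 × T2) : ℝ :=
  (1 / 2) * ∑ i : Fin 2, K (z.1 - z.2) i * (pd i φ z.1 - pd i φ z.2)

/-- The random variable `Y` is `⟨b(ω), φ⟩ = ⟨ω ⊗ ω, H_φ⟩`, renormalised. -/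
def IsNonlinearTerm {s : ℝ} (μ : Measure (Sobolev s)) (K : T2 → Fin 2 → ℝ) (φ : SmoothFun)
    (Y : Sobolev s → ℝ) : Prop :=
  IsTensorLimit μ (kerH K φ.1) 0 Y

end Enstrophy

end

/-!
The argument rests on one estimate for Gaussian quadratic forms. If `ξ` is a standard Gaussian
vector and `A` a matrix with Hilbert–Schmidt norm at most `r < 1 / 2`, then `E exp (ξᵀAξ - tr A) ≤
exp (2r² / (1 - 2r))`, whatever the dimension (`lintegral_exp_quadratic_le`). By rotation
invariance `A` may be taken diagonal, and then the expectation is a product of factors `(1 -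
2a)^(-1/2) e^(-a) ≤ exp (2a² / (1 - 2r))`.

In the orthonormal basis `cos (2π n·x) + sin (2π n·x)`, `n ∈ ℤ²`, white noise is a sequence of
independent standard Gaussian variables. For a continuous kernel `F` of class `H^{2+}` the
functional `⟨ω ⊗ ω, F⟩ - ∫ F(x, x) dx` is the almost sure limit of centred quadratic forms: the
Fourier series of `F` converges absolutely, so that the traces of the truncated matrices converge
to the diagonal integral (`tendsto_chaosSum`), and the Hilbert–Schmidt norms are at most the `L²`
norm of `F` by Bessel's inequality. Fatou's lemma then yields the exponential bound for `F`, and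
by scaling `F` a bound of the variance by a multiple of `‖F‖²` in `L²`. The variance bound gives
existence and uniqueness of `⟨ω ⊗ ω, f⟩_c` for every square integrable `f`; prescribing `c` is
possible because there are trigonometric polynomials of diagonal integral one and arbitrarily
small `L²` norm (`exists_trigPoly_diagonal`). The exponential bound, with Fatou's lemma again,
gives exponential integrability for `ε ‖f‖ < 1 / 2`, where the `L²` norm is at most the supremum
norm.

For the nonlinear term it remains to see that `H_φ` is square integrable
(`IsBiotSavart.memLp_kerH`). As `∇φ` is Lipschitz, `|H_φ(x, y)|` is bounded by a multiple of the
sum over `i, j` of `|K_i(z)| |e_j(z) - 1|`, with `z = x - y` and `e_1, e_2` the characters of unit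
frequency. The equations for `K` determine its Fourier coefficients, a multiple of `n^⊥ / |n|²`,
and those of `K_i (e_j - 1)` are differences of coefficients at neighbouring frequencies. By the
identity for inversions of the plane these are of order `|n|⁻²`, hence square summable.
-/

namespace Enstrophy

open UnitAddTorus

/-! ### Exponential moments of Gaussian quadratic forms -/

/-- The exponential moment is `(1 - 2a)^(-1/2) e^(-a)`, finite for `a < 1 / 2`. Subtracting the mean
makes it `1 + O(a²)`, so that infinite products converge for square summable `a`. -/
theorem lintegral_exp_mul_sq_sub_one_le {a ρ : ℝ} (ha : a ≤ ρ) (hρ : ρ < 1 / 2) :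
    ∫⁻ x, ENNReal.ofReal (Real.exp (a * (x ^ 2 - 1))) ∂gaussianReal 0 1 ≤
      ENNReal.ofReal (Real.exp (2 * a ^ 2 / (1 - 2 * ρ))) := by
  have h1 : 0 < 1 - 2 * a := by linarith
  have h2 : 0 < 1 - 2 * ρ := by linarith
  set v : NNReal := ⟨(1 - 2 * a)⁻¹, by positivity⟩ with hv
  have hv' : (v : ℝ) = (1 - 2 * a)⁻¹ := rfl
  have hv0 : v ≠ 0 := by
    intro h
    have : (v : ℝ) = 0 := by rw [h]; rfl
    rw [hv'] at this
    exact (inv_pos.2 h1).ne' this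
  rw [gaussianReal_of_var_ne_zero _ one_ne_zero,
    lintegral_withDensity_eq_lintegral_mul _ (measurable_gaussianPDF 0 1) (by fun_prop)]
  -- the integrand is a multiple of a Gaussian density of variance `1 / (1 - 2a)`
  have key : ∀ x : ℝ, (gaussianPDF 0 1 * fun x => ENNReal.ofReal (Real.exp (a * (x ^ 2 - 1)))) x =
      ENNReal.ofReal (Real.sqrt (1 - 2 * a)⁻¹ * Real.exp (-a)) * gaussianPDF 0 v x := by
    intro x
    simp only [Pi.mul_apply, gaussianPDF]
    rw [← ENNReal.ofReal_mul (gaussianPDFReal_nonneg _ _ _), ← ENNReal.ofReal_mul (by positivity)]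
    congr 1
    simp only [gaussianPDFReal, hv', NNReal.coe_one, sub_zero, mul_one]
    have e1 : Real.exp (-x ^ 2 / 2) * Real.exp (a * (x ^ 2 - 1)) =
        Real.exp (-a) * Real.exp (-x ^ 2 / (2 * (1 - 2 * a)⁻¹)) := by
      rw [← Real.exp_add, ← Real.exp_add]
      congr 1
      field_simp
      ring
    rw [mul_assoc, e1, Real.sqrt_mul (by positivity) (1 - 2 * a)⁻¹]
    have : Real.sqrt (1 - 2 * a)⁻¹ ≠ 0 := (Real.sqrt_pos.2 (inv_pos.2 h1)).ne'
    field_simp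
  rw [lintegral_congr key, lintegral_const_mul _ (measurable_gaussianPDF 0 v),
    lintegral_gaussianPDF_eq_one 0 hv0, mul_one]
  apply ENNReal.ofReal_le_ofReal
  have hlog : Real.log (1 - 2 * a)⁻¹ ≤ (1 - 2 * a)⁻¹ - 1 :=
    Real.log_le_sub_one_of_pos (inv_pos.2 h1)
  have hs : Real.sqrt (1 - 2 * a)⁻¹ = Real.exp (Real.log (1 - 2 * a)⁻¹ / 2) := by
    rw [Real.sqrt_eq_rpow, Real.rpow_def_of_pos (inv_pos.2 h1)]
    congr 1
    ring
  rw [hs, ← Real.exp_add, Real.exp_le_exp]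
  have h3 : ((1 - 2 * a)⁻¹ - 1) / 2 + -a = 2 * a ^ 2 / (1 - 2 * a) := by
    field_simp
    ring
  have h4 : 2 * a ^ 2 / (1 - 2 * a) ≤ 2 * a ^ 2 / (1 - 2 * ρ) := by
    gcongr
  linarith

theorem lintegral_exp_diag_quadratic_le {ι : Type*} [Fintype ι] (l : ι → ℝ) {r : ℝ}
    (hr0 : 0 ≤ r) (hr : r < 1 / 2) (hl : ∑ k, l k ^ 2 ≤ r ^ 2) :
    ∫⁻ g, ENNReal.ofReal (Real.exp (∑ k, l k * (g k ^ 2 - 1)))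
        ∂(Measure.pi fun _ : ι => gaussianReal 0 1) ≤
      ENNReal.ofReal (Real.exp (2 * r ^ 2 / (1 - 2 * r))) := by
  have hlk : ∀ k, l k ≤ r := fun k => by
    have : l k ^ 2 ≤ r ^ 2 :=
      (Finset.single_le_sum (f := fun k => l k ^ 2) (fun i _ => sq_nonneg _)
        (Finset.mem_univ k)).trans hl
    exact le_of_abs_le (abs_le_of_sq_le_sq this hr0)
  have hind : iIndepFun (fun k (g : ι → ℝ) => ENNReal.ofReal (Real.exp (l k * (g k ^ 2 - 1))))
      (Measure.pi fun _ : ι => gaussianReal 0 1) :=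
    iIndepFun_pi (X := fun k x => ENNReal.ofReal (Real.exp (l k * (x ^ 2 - 1))))
      (fun k => by fun_prop)
  have hprod : ∀ g : ι → ℝ, ENNReal.ofReal (Real.exp (∑ k, l k * (g k ^ 2 - 1))) =
      ∏ k, ENNReal.ofReal (Real.exp (l k * (g k ^ 2 - 1))) := fun g => by
    rw [Real.exp_sum, ENNReal.ofReal_prod_of_nonneg fun _ _ => (Real.exp_pos _).le]
  simp_rw [hprod]
  rw [lintegral_prod_eq_prod_lintegral_of_indepFun Finset.univ _ hind (fun k => by fun_prop)]
  calc ∏ k, ∫⁻ g : ι → ℝ, ENNReal.ofReal (Real.exp (l k * (g k ^ 2 - 1)))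
          ∂(Measure.pi fun _ : ι => gaussianReal 0 1)
      ≤ ∏ k, ENNReal.ofReal (Real.exp (2 * l k ^ 2 / (1 - 2 * r))) := by
        refine Finset.prod_le_prod' fun k _ => ?_
        have := (measurePreserving_eval (fun _ : ι => gaussianReal 0 1) k).lintegral_comp
          (f := fun x => ENNReal.ofReal (Real.exp (l k * (x ^ 2 - 1)))) (by fun_prop)
        refine (le_of_eq this).trans (lintegral_exp_mul_sq_sub_one_le (hlk k) hr)
    _ = ENNReal.ofReal (Real.exp (2 * (∑ k, l k ^ 2) / (1 - 2 * r))) := by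
        rw [← ENNReal.ofReal_prod_of_nonneg fun _ _ => (Real.exp_pos _).le, ← Real.exp_sum,
          Finset.mul_sum, Finset.sum_div]
    _ ≤ _ := by
        apply ENNReal.ofReal_le_ofReal
        rw [Real.exp_le_exp]
        have : 0 < 1 - 2 * r := by linarith
        gcongr

/-- Diagonalising the form reduces this to `lintegral_exp_diag_quadratic_le`: the law is invariant
under rotations, and neither the trace nor the Hilbert–Schmidt norm depends on the basis. -/
theorem lintegral_exp_quadratic_le {ι : Type*} [Fintype ι] [DecidableEq ι] (A : Matrix ι ι ℝ)
    {r : ℝ} (hr0 : 0 ≤ r) (hr : r < 1 / 2) (hA : ∑ i, ∑ j, A i j ^ 2 ≤ r ^ 2) :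
    ∫⁻ x, ENNReal.ofReal (Real.exp (∑ i, ∑ j, A i j * (x i * x j) - ∑ i, A i i))
        ∂stdGaussian (EuclideanSpace ℝ ι) ≤
      ENNReal.ofReal (Real.exp (2 * r ^ 2 / (1 - 2 * r))) := by
  -- only the symmetric part of `A` enters the form
  set B : Matrix ι ι ℝ := fun i j => (A i j + A j i) / 2 with hB
  have hBh : B.IsHermitian := by
    ext i j
    rw [Matrix.conjTranspose_apply]
    simp only [hB, star_trivial, add_comm]
  have hquad : ∀ x : EuclideanSpace ℝ ι,
      ∑ i, ∑ j, A i j * (x i * x j) = ∑ i, ∑ j, B i j * (x i * x j) := fun x => by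
    have h : ∑ i, ∑ j, A j i * (x i * x j) = ∑ i, ∑ j, A i j * (x i * x j) := by
      rw [Finset.sum_comm]
      simp_rw [mul_comm (x _) (x _)]
    have h2 : ∑ i, ∑ j, B i j * (x i * x j) = (∑ i, ∑ j, A i j * (x i * x j) +
        ∑ i, ∑ j, A j i * (x i * x j)) / 2 := by
      simp_rw [← Finset.sum_add_distrib, Finset.sum_div]
      refine Finset.sum_congr rfl fun i _ => Finset.sum_congr rfl fun j _ => ?_
      simp only [hB]
      ring
    rw [h2, h]
    ring
  have htr : ∑ i, A i i = ∑ k, hBh.eigenvalues k := by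
    have := hBh.trace_eq_sum_eigenvalues
    simp only [RCLike.ofReal_real_eq_id, id] at this
    rw [← this]
    refine Finset.sum_congr rfl fun i _ => ?_
    change A i i = (A i i + A i i) / 2
    ring
  have hBs : ∑ i, ∑ j, B i j ^ 2 ≤ r ^ 2 := by
    refine le_trans ?_ hA
    have h : ∑ i, ∑ j, A j i ^ 2 = ∑ i, ∑ j, A i j ^ 2 := Finset.sum_comm
    have h2 : ∑ i, ∑ j, B i j ^ 2 ≤ (∑ i, ∑ j, A i j ^ 2 + ∑ i, ∑ j, A j i ^ 2) / 2 := by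
      simp_rw [← Finset.sum_add_distrib, Finset.sum_div]
      refine Finset.sum_le_sum fun i _ => Finset.sum_le_sum fun j _ => ?_
      simp only [hB]
      nlinarith [sq_nonneg (A i j - A j i)]
    linarith
  set b := hBh.eigenvectorBasis with hb
  have heig : ∀ k i, ∑ j, B i j * b k j = hBh.eigenvalues k * b k i := fun k i => by
    have := congrFun (hBh.mulVec_eigenvectorBasis k) i
    simpa [Matrix.mulVec, dotProduct] using this
  have hl : ∑ k, hBh.eigenvalues k ^ 2 ≤ r ^ 2 := by
    refine le_trans (le_of_eq ?_) hBs
    have h1 : ∀ k, hBh.eigenvalues k ^ 2 = ∑ i, (∑ j, B i j * b k j) ^ 2 := fun k => by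
      simp_rw [heig, mul_pow, ← Finset.mul_sum]
      have : ‖b k‖ ^ 2 = ∑ i, b k i ^ 2 := by
        rw [EuclideanSpace.real_norm_sq_eq]
      rw [← this, b.norm_eq_one]
      ring
    simp_rw [h1]
    rw [Finset.sum_comm]
    refine Finset.sum_congr rfl fun i _ => ?_
    have h2 := b.sum_sq_inner_right (WithLp.toLp 2 (B i))
    rw [EuclideanSpace.real_norm_sq_eq] at h2
    simp only at h2
    rw [← h2]
    refine Finset.sum_congr rfl fun k _ => ?_
    congr 1
  rw [stdGaussian_eq_map_pi_orthonormalBasis b,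
    lintegral_map (by fun_prop) (by fun_prop)]
  refine le_trans (le_of_eq (lintegral_congr fun g => ?_))
    (lintegral_exp_diag_quadratic_le hBh.eigenvalues hr0 hr hl)
  congr 2
  rw [hquad, htr]
  have hx : ∀ i, (∑ k, g k • b k : EuclideanSpace ℝ ι) i = ∑ k, g k * b k i := fun i => by
    simp
  have h3 : ∀ i, ∑ j, B i j * ((∑ k, g k • b k : EuclideanSpace ℝ ι) j) =
      (∑ k, (g k * hBh.eigenvalues k) • b k : EuclideanSpace ℝ ι) i := fun i => by
    simp_rw [hx]
    simp_rw [Finset.mul_sum]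
    rw [Finset.sum_comm]
    simp only [WithLp.ofLp_sum, WithLp.ofLp_smul, Finset.sum_apply, Pi.smul_apply, smul_eq_mul]
    refine Finset.sum_congr rfl fun k _ => ?_
    rw [mul_assoc, ← heig, Finset.mul_sum]
    exact Finset.sum_congr rfl fun j _ => by ring
  have h4 : ∑ i, ∑ j, B i j * ((∑ k, g k • b k : EuclideanSpace ℝ ι) i *
      (∑ k, g k • b k : EuclideanSpace ℝ ι) j) =
      inner ℝ (∑ k, (g k * hBh.eigenvalues k) • b k) (∑ k, g k • b k) := by
    simp only [PiLp.inner_apply]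
    refine Finset.sum_congr rfl fun i _ => ?_
    rw [← h3]
    simp only [RCLike.inner_apply, conj_trivial, Finset.mul_sum]
    exact Finset.sum_congr rfl fun j _ => by ring
  rw [h4, b.orthonormal.inner_sum, ← Finset.sum_sub_distrib]
  refine Finset.sum_congr rfl fun k _ => ?_
  simp
  ring

/-! ### Fourier modes on `T² × T²` and the Hartley basis -/

theorem integral_mFourier (n : Z2) : ∫ x, mFourier n x ∂dx = if n = 0 then 1 else 0 := by
  have h := orthonormal_iff_ite.1 (orthonormal_mFourier (d := Fin 2)) 0 n
  simp only [ContinuousMap.inner_toLp, ← mFourier_neg, ← mFourier_add, neg_zero, add_zero] at h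
  simp only [eq_comm (a := n)]
  exact h

/-- The function `eₙ ⊗ eₘ` on `T² × T²`. -/
noncomputable def tensorMode (p : Z2 × Z2) : C(T2 × T2, ℂ) :=
  ⟨fun z => mFourier p.1 z.1 * mFourier p.2 z.2, by fun_prop⟩

theorem tensorMode_apply (p : Z2 × Z2) (z : T2 × T2) :
    tensorMode p z = mFourier p.1 z.1 * mFourier p.2 z.2 := rfl

theorem tensorMode_add (p q : Z2 × Z2) (z : T2 × T2) :
    tensorMode (p + q) z = tensorMode p z * tensorMode q z := by
  simp only [tensorMode_apply, Prod.fst_add, Prod.snd_add, mFourier_add]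
  ring

theorem tensorMode_neg (p : Z2 × Z2) (z : T2 × T2) :
    tensorMode (-p) z = (starRingEnd ℂ) (tensorMode p z) := by
  simp only [tensorMode_apply, Prod.fst_neg, Prod.snd_neg, mFourier_neg, map_mul]

theorem norm_mFourier_apply (n : Z2) (x : T2) : ‖mFourier n x‖ = 1 := by
  simp [mFourier, fourier_apply, -Fin.prod_univ_two, norm_prod, Circle.norm_coe]

theorem norm_tensorMode_apply (p : Z2 × Z2) (z : T2 × T2) : ‖tensorMode p z‖ = 1 := by
  rw [tensorMode_apply, norm_mul, norm_mFourier_apply, norm_mFourier_apply, one_mul]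

theorem integral_tensorMode (p : Z2 × Z2) :
    ∫ z, tensorMode p z ∂dxdy = if p = 0 then 1 else 0 := by
  simp only [tensorMode_apply]
  rw [integral_prod_mul (μ := dx) (ν := dx) (fun x => mFourier p.1 x) (fun x => mFourier p.2 x),
    integral_mFourier, integral_mFourier]
  by_cases h1 : p.1 = 0 <;> by_cases h2 : p.2 = 0 <;> simp [h1, h2, Prod.ext_iff]

theorem coeff₂_eq (f : T2 × T2 → ℝ) (p : Z2 × Z2) :
    coeff₂ f p = ∫ z, tensorMode (-p) z * (f z : ℂ) ∂dxdy := rfl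

/-- The function `x ↦ cos (2π n·x) + sin (2π n·x)`. For `n ∈ ℤ²` these functions form an orthonormal
basis of the real space `L²(T²)`. -/
noncomputable def casMode (n : Z2) : SmoothFun := cosMode n + sinMode n

theorem casMode_apply (n : Z2) (x : T2) :
    (casMode n).1 x = (mFourier n x).re + (mFourier n x).im := rfl

theorem continuous_casMode (n : Z2) : Continuous (casMode n).1 := by
  change Continuous fun x => (mFourier n x).re + (mFourier n x).im
  fun_prop

theorem integrable_of_continuous {X E : Type*} [TopologicalSpace X] [CompactSpace X]
    [MeasurableSpace X] [BorelSpace X] [NormedAddCommGroup E] [SecondCountableTopology E]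
    [MeasurableSpace E] [BorelSpace E]
    {ν : Measure X} [IsFiniteMeasure ν] {f : X → E} (hf : Continuous f) : Integrable f ν :=
  (BoundedContinuousFunction.mkOfCompact ⟨f, hf⟩).integrable ν

theorem integral_casMode_mul (n m : Z2) :
    ∫ x, (casMode n).1 x * (casMode m).1 x ∂dx = if n = m then 1 else 0 := by
  have h : ∀ x, (casMode n).1 x * (casMode m).1 x =
      (mFourier (n + -m) x).re + (mFourier (n + m) x).im := fun x => by
    simp only [casMode_apply, mFourier_add, mFourier_neg, Complex.mul_re, Complex.mul_im,
      Complex.conj_re, Complex.conj_im]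
    ring
  have hi : ∀ k : Z2, Integrable (fun x => mFourier k x) dx := fun k =>
    integrable_of_continuous (mFourier k).continuous
  simp_rw [h]
  have h1 : ∫ x, (mFourier (n + -m) x).re ∂dx = (∫ x, mFourier (n + -m) x ∂dx).re :=
    integral_re (hi (n + -m))
  have h2 : ∫ x, (mFourier (n + m) x).im ∂dx = (∫ x, mFourier (n + m) x ∂dx).im :=
    integral_im (hi (n + m))
  rw [integral_add (f := fun x => (mFourier (n + -m) x).re) (g := fun x => (mFourier (n + m) x).im)
    (hi (n + -m)).re (hi (n + m)).im, h1, h2, integral_mFourier, integral_mFourier,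
    ← sub_eq_add_neg]
  simp only [sub_eq_zero]
  split_ifs <;> simp

/-- The coefficient of a function on `T² × T²` at `casMode n ⊗ casMode m`. -/
noncomputable def hartleyCoeff (f : T2 × T2 → ℝ) (p : Z2 × Z2) : ℝ :=
  ∫ z, f z * ((casMode p.1).1 z.1 * (casMode p.2).1 z.2) ∂dxdy

/-- Over a set of frequencies symmetric about `0`, the complex and the Hartley partial sums agree:
the difference is a sum of odd terms. -/
theorem sum_mFourier_eq_sum_casMode {S : Finset Z2} (hS : ∀ n ∈ S, -n ∈ S) {w : Z2 → ℂ}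
    (hw : ∀ n, w (-n) = (starRingEnd ℂ) (w n)) (x : T2) :
    ∑ n ∈ S, mFourier (-n) x * w n =
      ((∑ n ∈ S, (casMode n).1 x * ((w n).re + (w n).im) : ℝ) : ℂ) := by
  have hodd : ∀ g : Z2 → ℝ, (∀ n, g (-n) = -g n) → ∑ n ∈ S, g n = 0 := fun g hg => by
    have h : ∑ n ∈ S, g n = ∑ n ∈ S, g (-n) :=
      Finset.sum_bij' (fun n _ => -n) (fun n _ => -n) hS hS (by simp) (by simp) (by simp)
    simp_rw [hg, Finset.sum_neg_distrib] at h
    linarith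
  have hre : ∀ n, (w (-n)).re = (w n).re := fun n => by rw [hw, Complex.conj_re]
  have him : ∀ n, (w (-n)).im = -(w n).im := fun n => by rw [hw, Complex.conj_im]
  apply Complex.ext
  · rw [Complex.re_sum, Complex.ofReal_re, ← sub_eq_zero, ← Finset.sum_sub_distrib]
    refine hodd _ fun n => ?_
    simp only [casMode_apply, mFourier_neg, Complex.mul_re, Complex.conj_re, Complex.conj_im,
      hre, him]
    ring
  · rw [Complex.im_sum, Complex.ofReal_im]
    refine hodd _ fun n => ?_
    simp only [mFourier_neg, Complex.mul_im, Complex.conj_re, Complex.conj_im, hre, him]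
    ring

/-- The instance `w = ω.coeff` rewrites the dual pairing in real coordinates, and `w n = eₙ(x)` the
restriction to the diagonal. -/
theorem sum_coeff₂_eq_sum_hartleyCoeff {S : Finset Z2} (hS : ∀ n ∈ S, -n ∈ S) {w : Z2 → ℂ}
    (hw : ∀ n, w (-n) = (starRingEnd ℂ) (w n)) {f : T2 × T2 → ℝ} (hf : Integrable f dxdy) :
    ∑ p ∈ S ×ˢ S, coeff₂ f p * (w p.1 * w p.2) =
      ((∑ p ∈ S ×ˢ S, hartleyCoeff f p *
        (((w p.1).re + (w p.1).im) * ((w p.2).re + (w p.2).im)) : ℝ) : ℂ) := by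
  have hint1 : ∀ p : Z2 × Z2, Integrable (fun z => tensorMode (-p) z * (f z : ℂ)) dxdy := fun p =>
    hf.ofReal.bdd_mul (c := 1) (tensorMode (-p)).continuous.aestronglyMeasurable
      (ae_of_all _ fun z => (norm_tensorMode_apply _ z).le)
  have hint2 : ∀ p : Z2 × Z2, Integrable
      (fun z => f z * ((casMode p.1).1 z.1 * (casMode p.2).1 z.2)) dxdy := fun p => by
    have hc : Continuous fun z : T2 × T2 => (casMode p.1).1 z.1 * (casMode p.2).1 z.2 :=
      ((continuous_casMode _).comp continuous_fst).mul ((continuous_casMode _).comp continuous_snd)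
    obtain ⟨C, hC⟩ := (isCompact_range hc).isBounded.exists_norm_le
    exact hf.mul_bdd (c := C) hc.aestronglyMeasurable (ae_of_all _ fun z => hC _ ⟨z, rfl⟩)
  have h1 : ∑ p ∈ S ×ˢ S, coeff₂ f p * (w p.1 * w p.2) =
      ∫ z, ((∑ n ∈ S, mFourier (-n) z.1 * w n) * (∑ n ∈ S, mFourier (-n) z.2 * w n)) * (f z : ℂ)
        ∂dxdy := by
    simp_rw [Finset.sum_mul_sum, ← Finset.sum_product', Finset.sum_mul, coeff₂_eq,
      ← integral_mul_const]
    rw [← integral_finsetSum _ fun p _ => (hint1 p).mul_const _]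
    refine integral_congr_ae (ae_of_all _ fun z => Finset.sum_congr rfl fun p _ => ?_)
    simp only [tensorMode_apply, Prod.fst_neg, Prod.snd_neg]
    ring
  have h2 : ∑ p ∈ S ×ˢ S, hartleyCoeff f p *
        (((w p.1).re + (w p.1).im) * ((w p.2).re + (w p.2).im)) =
      ∫ z, (((∑ n ∈ S, (casMode n).1 z.1 * ((w n).re + (w n).im)) *
        (∑ n ∈ S, (casMode n).1 z.2 * ((w n).re + (w n).im))) * f z) ∂dxdy := by
    simp_rw [Finset.sum_mul_sum, ← Finset.sum_product', Finset.sum_mul, hartleyCoeff,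
      ← integral_mul_const]
    rw [← integral_finsetSum _ fun p _ => (hint2 p).mul_const _]
    refine integral_congr_ae (ae_of_all _ fun z => Finset.sum_congr rfl fun p _ => ?_)
    ring
  rw [h1, h2, ← integral_complex_ofReal]
  refine integral_congr_ae (ae_of_all _ fun z => ?_)
  simp only
  rw [sum_mFourier_eq_sum_casMode hS hw, sum_mFourier_eq_sum_casMode hS hw]
  push_cast
  rfl

/-- Bessel's inequality for the orthonormal family `casMode n ⊗ casMode m`. -/
theorem sum_hartleyCoeff_sq_le (F : C(T2 × T2, ℝ)) (s : Finset (Z2 × Z2)) :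
    ∑ p ∈ s, hartleyCoeff F p ^ 2 ≤ ∫ z, F z ^ 2 ∂dxdy := by
  set u : Z2 × Z2 → C(T2 × T2, ℝ) := fun p =>
    ⟨fun z => (casMode p.1).1 z.1 * (casMode p.2).1 z.2,
      ((continuous_casMode _).comp continuous_fst).mul
        ((continuous_casMode _).comp continuous_snd)⟩ with hu
  have horth : Orthonormal ℝ fun p => ContinuousMap.toLp (E := ℝ) 2 dxdy ℝ (u p) := by
    rw [orthonormal_iff_ite]
    intro p q
    rw [ContinuousMap.inner_toLp]
    have : ∀ z, u q z * (starRingEnd ℝ) (u p z) =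
        ((casMode p.1).1 z.1 * (casMode q.1).1 z.1) *
          ((casMode p.2).1 z.2 * (casMode q.2).1 z.2) := fun z => by
      simp only [hu, ContinuousMap.coe_mk, conj_trivial]
      ring
    simp_rw [this]
    rw [integral_prod_mul (μ := dx) (ν := dx) (fun x => (casMode p.1).1 x * (casMode q.1).1 x)
      (fun x => (casMode p.2).1 x * (casMode q.2).1 x), integral_casMode_mul, integral_casMode_mul]
    by_cases h1 : p.1 = q.1 <;> by_cases h2 : p.2 = q.2 <;> simp [h1, h2, Prod.ext_iff]
  have h := horth.sum_inner_products_le (ContinuousMap.toLp (E := ℝ) 2 dxdy ℝ F) (s := s)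
  rw [← real_inner_self_eq_norm_sq, ContinuousMap.inner_toLp] at h
  simp only [ContinuousMap.inner_toLp, conj_trivial, Real.norm_eq_abs, sq_abs] at h
  simp only [← pow_two] at h
  exact h

/-- The frequencies `n` with `|n₁|, |n₂| ≤ N`. -/
noncomputable def box (N : ℕ) : Finset Z2 := Finset.Icc (fun _ => -(N : ℤ)) (fun _ => (N : ℤ))

theorem mem_box {N : ℕ} {n : Z2} : n ∈ box N ↔ ∀ i, |n i| ≤ N := by
  simp only [box, Finset.mem_Icc, Pi.le_def, abs_le, forall_and]

theorem neg_mem_box {N : ℕ} (n : Z2) (hn : n ∈ box N) : -n ∈ box N := by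
  rw [mem_box] at *
  simpa using hn

theorem tendsto_box : Tendsto (fun N => box N ×ˢ box N) atTop atTop := by
  refine tendsto_atTop_finset_of_monotone (fun N M hNM => ?_) fun p => ?_
  · refine Finset.product_subset_product ?_ ?_ <;>
    · intro n hn
      rw [mem_box] at *
      exact fun i => (hn i).trans (by exact_mod_cast hNM)
  · refine ⟨(∑ i, (p.1 i).natAbs) + ∑ i, (p.2 i).natAbs, ?_⟩
    rw [Finset.mem_product, mem_box, mem_box]
    have key : ∀ (q : Z2) (i : Fin 2), |q i| ≤ ((∑ i, (q i).natAbs : ℕ) : ℤ) := fun q i => by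
      rw [Int.abs_eq_natAbs]
      exact_mod_cast Finset.single_le_sum (f := fun i => (q i).natAbs)
        (fun _ _ => Nat.zero_le _) (Finset.mem_univ i)
    refine ⟨fun i => (key p.1 i).trans ?_, fun i => (key p.2 i).trans ?_⟩ <;>
    · push_cast
      linarith [Finset.sum_nonneg fun i (_ : i ∈ Finset.univ) => abs_nonneg (p.1 i),
        Finset.sum_nonneg fun i (_ : i ∈ Finset.univ) => abs_nonneg (p.2 i)]

/-! ### Fourier inversion and density of trigonometric polynomials on `T² × T²` -/

section HaarVolume

/-- The volume of the circle is its normalised Haar measure, as in Mathlib's Fourier analysis on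
`UnitAddTorus`; the volume of `T2` is then `dx`. -/
noncomputable local instance : MeasureSpace UnitAddCircle := ⟨AddCircle.haarAddCircle⟩

/-- The identification of the four-dimensional torus with `T² × T²`. -/
def splitTorus : UnitAddTorus (Fin 2 ⊕ Fin 2) ≃ᵐ T2 × T2 :=
  MeasurableEquiv.sumPiEquivProdPi fun _ => UnitAddCircle

theorem splitTorus_apply (w : UnitAddTorus (Fin 2 ⊕ Fin 2)) :
    splitTorus w = (fun i => w (Sum.inl i), fun i => w (Sum.inr i)) := rfl

theorem continuous_splitTorus : Continuous splitTorus := by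
  change Continuous fun w : UnitAddTorus (Fin 2 ⊕ Fin 2) =>
    ((fun i => w (Sum.inl i), fun i => w (Sum.inr i)) : T2 × T2)
  fun_prop

theorem measurePreserving_splitTorus :
    MeasurePreserving splitTorus (volume : Measure (UnitAddTorus (Fin 2 ⊕ Fin 2))) dxdy :=
  haveI : SigmaFinite (volume : Measure UnitAddCircle) :=
    inferInstanceAs (SigmaFinite AddCircle.haarAddCircle)
  volume_measurePreserving_sumPiEquivProdPi fun _ => UnitAddCircle

/-- The frequencies of the four-dimensional torus are those of `T² × T²`. -/
def splitFreq : (Fin 2 ⊕ Fin 2 → ℤ) ≃ Z2 × Z2 := Equiv.sumArrowEquivProdArrow _ _ _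

theorem mFourier_eq_tensorMode (k : Fin 2 ⊕ Fin 2 → ℤ) (w : UnitAddTorus (Fin 2 ⊕ Fin 2)) :
    mFourier k w = tensorMode (splitFreq k) (splitTorus w) := by
  simp only [tensorMode_apply, splitTorus_apply, mFourier, ContinuousMap.coe_mk,
    Fintype.prod_sum_type]
  rfl

theorem mFourierCoeff_comp_splitTorus (f : T2 × T2 → ℝ) (k : Fin 2 ⊕ Fin 2 → ℤ) :
    mFourierCoeff (fun w => (f (splitTorus w) : ℂ)) k = coeff₂ f (splitFreq k) := by
  rw [coeff₂_eq, ← measurePreserving_splitTorus.integral_comp' (f := splitTorus)]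
  simp only [mFourierCoeff, mFourier_eq_tensorMode, smul_eq_mul]
  rfl

/-- A continuous function whose Fourier coefficients are summable is the sum of its Fourier
series. -/
theorem hasSum_coeff₂ (F : C(T2 × T2, ℝ)) (hF : Summable (coeff₂ F)) (z : T2 × T2) :
    HasSum (fun p => coeff₂ F p * tensorMode p z) (F z : ℂ) := by
  set G : C(UnitAddTorus (Fin 2 ⊕ Fin 2), ℂ) :=
    ⟨fun w => (F (splitTorus w) : ℂ),
      Complex.continuous_ofReal.comp (F.continuous.comp continuous_splitTorus)⟩
  have hG : ∀ k, mFourierCoeff G k = coeff₂ F (splitFreq k) := mFourierCoeff_comp_splitTorus F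
  have hs : Summable (mFourierCoeff G) := by
    simp_rw [funext hG]
    exact splitFreq.summable_iff.2 hF
  have h := hasSum_mFourier_series_apply_of_summable hs (splitTorus.symm z)
  rw [← splitFreq.hasSum_iff]
  convert! h using 1
  · funext k
    simp [hG, mFourier_eq_tensorMode]

/-- The real trigonometric polynomial `∑ Re (cₚ eₚ)`. -/
noncomputable def trigPoly (s : Finset (Z2 × Z2)) (c : Z2 × Z2 → ℂ) : C(T2 × T2, ℝ) :=
  ⟨fun z => (∑ p ∈ s, c p * tensorMode p z).re, by fun_prop⟩

theorem trigPoly_apply (s : Finset (Z2 × Z2)) (c : Z2 × Z2 → ℂ) (z : T2 × T2) :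
    trigPoly s c z = (∑ p ∈ s, c p * tensorMode p z).re := rfl

theorem integral_mode_mul_re (a : ℂ) (p q : Z2 × Z2) (h1 : q ≠ p) (h2 : -q ≠ p) :
    ∫ z, tensorMode (-q) z * ((a * tensorMode p z).re : ℂ) ∂dxdy = 0 := by
  have h : ∀ z, tensorMode (-q) z * ((a * tensorMode p z).re : ℂ) =
      a / 2 * tensorMode (-q + p) z + (starRingEnd ℂ) a / 2 * tensorMode (-q + -p) z := fun z => by
    rw [Complex.re_eq_add_conj, tensorMode_add, tensorMode_add, tensorMode_neg p, map_mul]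
    ring
  simp_rw [h]
  rw [integral_add, integral_const_mul, integral_const_mul, integral_tensorMode,
    integral_tensorMode, if_neg, if_neg]
  · simp
  · intro h0
    exact h2 (by rw [← sub_eq_add_neg, sub_eq_zero] at h0; exact h0)
  · intro h0
    exact h1 (by rw [neg_add_eq_zero] at h0; exact h0)
  · exact (integrable_of_continuous (tensorMode _).continuous).const_mul _
  · exact (integrable_of_continuous (tensorMode _).continuous).const_mul _

theorem coeff₂_trigPoly_eq_zero (s : Finset (Z2 × Z2)) (c : Z2 × Z2 → ℂ) (q : Z2 × Z2)
    (h1 : q ∉ s) (h2 : -q ∉ s) : coeff₂ (trigPoly s c) q = 0 := by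
  simp only [coeff₂_eq, trigPoly_apply, Complex.re_sum, Complex.ofReal_sum, Finset.mul_sum]
  rw [integral_finsetSum]
  · refine Finset.sum_eq_zero fun p hp => integral_mode_mul_re _ _ _ ?_ ?_
    · rintro rfl
      exact h1 hp
    · rintro rfl
      exact h2 hp
  · intro p _
    refine integrable_of_continuous ?_
    fun_prop

theorem coeff₂_add (F G : C(T2 × T2, ℝ)) (p : Z2 × Z2) :
    coeff₂ (F + G : C(T2 × T2, ℝ)) p = coeff₂ F p + coeff₂ G p := by
  simp only [coeff₂_eq]
  rw [← integral_add]
  · refine integral_congr_ae (ae_of_all _ fun z => ?_)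
    simp [mul_add]
  · exact integrable_of_continuous (by fun_prop)
  · exact integrable_of_continuous (by fun_prop)

theorem coeff₂_smul (a : ℝ) (F : C(T2 × T2, ℝ)) (p : Z2 × Z2) :
    coeff₂ (a • F : C(T2 × T2, ℝ)) p = a * coeff₂ F p := by
  simp only [coeff₂_eq]
  rw [← integral_const_mul]
  refine integral_congr_ae (ae_of_all _ fun z => ?_)
  simp
  ring

theorem finite_support_coeff₂_trigPoly (s : Finset (Z2 × Z2)) (c : Z2 × Z2 → ℂ) :
    (Function.support (coeff₂ (trigPoly s c))).Finite := by
  refine (s.finite_toSet.union (s.finite_toSet.preimage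
    (f := fun q : Z2 × Z2 => -q) neg_injective.injOn)).subset fun q hq => ?_
  by_contra h
  simp only [Set.mem_union, Finset.mem_coe, Set.mem_preimage, not_or] at h
  exact hq (coeff₂_trigPoly_eq_zero s c q h.1 h.2)

theorem isH2Plus_of_finite_support {f : T2 × T2 → ℝ}
    (hf : (Function.support (coeff₂ f)).Finite) : IsH2Plus f := by
  refine ⟨1, one_pos, summable_of_hasFiniteSupport (hf.subset fun p hp => ?_)⟩
  contrapose! hp
  simp only [Function.mem_support, not_not] at hp ⊢
  simp [hp]

/-- Trigonometric polynomials are dense in `L²(T² × T²)`. -/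
theorem exists_trigPoly_eLpNorm_sub_le {f : T2 × T2 → ℝ} (hf : MemLp f 2 dxdy) {ε : ℝ}
    (hε : 0 < ε) :
    ∃ s c, eLpNorm (fun z => trigPoly s c z - f z) 2 dxdy ≤ ENNReal.ofReal ε := by
  have hg : MemLp (fun w => (f (splitTorus w) : ℂ)) 2
      (volume : Measure (UnitAddTorus (Fin 2 ⊕ Fin 2))) :=
    (hf.comp_measurePreserving measurePreserving_splitTorus).ofReal
  have hsum := hasSum_mFourier_series_L2 hg.toLp
  obtain ⟨t, ht⟩ := ((Metric.tendsto_nhds.1 hsum ε hε)).exists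
  refine ⟨t.map splitFreq.toEmbedding,
    fun p => mFourierCoeff hg.toLp (splitFreq.symm p), ?_⟩
  rw [dist_eq_norm, Lp.norm_def] at ht
  have h1 : eLpNorm (fun z => ((∑ p ∈ t.map splitFreq.toEmbedding,
      mFourierCoeff hg.toLp (splitFreq.symm p) * tensorMode p z) - (f z : ℂ))) 2 dxdy ≤
      ENNReal.ofReal ε := by
    rw [← measurePreserving_splitTorus.map_eq,
      splitTorus.measurableEmbedding.eLpNorm_map_measure]
    refine le_trans (le_of_eq (eLpNorm_congr_ae ?_))
      (ENNReal.le_ofReal_iff_toReal_le (Lp.eLpNorm_ne_top _) hε.le |>.2 ht.le)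
    have h2 : ∀ᵐ w ∂(volume : Measure (UnitAddTorus (Fin 2 ⊕ Fin 2))), ∀ k ∈ t,
        (mFourierCoeff hg.toLp k • mFourierLp 2 k :
          Lp ℂ 2 (volume : Measure (UnitAddTorus (Fin 2 ⊕ Fin 2)))) w =
        mFourierCoeff hg.toLp k * mFourier k w := by
      refine (Finset.eventually_all t).2 fun k _ => ?_
      filter_upwards [Lp.coeFn_smul (mFourierCoeff hg.toLp k) (mFourierLp 2 k),
        coeFn_mFourierLp 2 k] with w h3 h4
      rw [h3, Pi.smul_apply, h4, smul_eq_mul]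
    filter_upwards [h2, hg.coeFn_toLp, Lp.coeFn_sub (∑ k ∈ t, mFourierCoeff hg.toLp k •
      mFourierLp 2 k) hg.toLp, Lp.coeFn_finsetSum t (fun k => mFourierCoeff hg.toLp k •
      (mFourierLp 2 k : Lp ℂ 2 (volume : Measure (UnitAddTorus (Fin 2 ⊕ Fin 2)))))]
      with w h3 h4 h5 h6
    rw [h5, Pi.sub_apply, h4, h6, Finset.sum_apply, Finset.sum_congr rfl h3]
    simp [mFourier_eq_tensorMode]
  refine le_trans (eLpNorm_mono fun z => ?_) h1
  have : trigPoly (t.map splitFreq.toEmbedding)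
      (fun p => mFourierCoeff hg.toLp (splitFreq.symm p)) z - f z =
      ((∑ p ∈ t.map splitFreq.toEmbedding,
      mFourierCoeff hg.toLp (splitFreq.symm p) * tensorMode p z) - (f z : ℂ)).re := by
    rw [trigPoly_apply, Complex.sub_re, Complex.ofReal_re]
  rw [this]
  exact Complex.abs_re_le_norm _

/-- Functions concentrated near the diagonal: they have diagonal integral one, and yet they are
small in `L²`. -/
theorem exists_trigPoly_diagonal {ε : ℝ} (hε : 0 < ε) :
    ∃ s c, (∀ x, trigPoly s c (x, x) = 1) ∧ eLpNorm (trigPoly s c) 2 dxdy ≤ ENNReal.ofReal ε := by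
  obtain ⟨N, hN⟩ := exists_nat_gt (1 / ε ^ 2)
  have hN0 : (0 : ℝ) < N := lt_trans (by positivity) hN
  set T : Finset Z2 := (Finset.range N).image fun k : ℕ => (fun _ => (k : ℤ) : Z2) with hT
  have hcard : T.card = N := by
    rw [hT, Finset.card_image_of_injective, Finset.card_range]
    intro a b hab
    exact Int.ofNat_inj.1 (congrFun hab 0)
  -- the average over `N` frequencies of `Re (eₙ ⊗ e₋ₙ)` has squared `L²` norm at most `1 / N`
  set ι : Z2 → Z2 × Z2 := fun n => (n, -n) with hι
  have hinj : Function.Injective ι := fun a b hab => congrArg Prod.fst hab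
  have hcardS : (T.image ι).card = N := by rw [Finset.card_image_of_injective _ hinj, hcard]
  set c : Z2 × Z2 → ℂ := fun _ => ((1 / N : ℝ) : ℂ) with hc
  refine ⟨T.image ι, c, fun x => ?_, ?_⟩
  · have : ∀ p ∈ T.image ι, c p * tensorMode p (x, x) = ((1 / N : ℝ) : ℂ) := fun p hp => by
      obtain ⟨n, -, rfl⟩ := Finset.mem_image.1 hp
      simp only [hι, hc, tensorMode_apply, mFourier_neg, Complex.mul_conj,
        Complex.normSq_eq_norm_sq, norm_mFourier_apply]
      simp
    rw [trigPoly_apply, Finset.sum_congr rfl this, Finset.sum_const, hcardS]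
    rw [nsmul_eq_mul, ← Complex.ofReal_natCast, ← Complex.ofReal_mul, Complex.ofReal_re]
    field_simp
  · have horth : Orthonormal ℂ fun p => ContinuousMap.toLp (E := ℂ) 2 dxdy ℂ (tensorMode p) := by
      rw [orthonormal_iff_ite]
      intro p q
      rw [ContinuousMap.inner_toLp]
      simp_rw [← tensorMode_neg, ← tensorMode_add]
      rw [integral_tensorMode, ← sub_eq_add_neg]
      simp only [sub_eq_zero, eq_comm]
    set G : C(T2 × T2, ℂ) := ∑ p ∈ T.image ι, c p • tensorMode p with hG
    have hGn : ‖ContinuousMap.toLp (E := ℂ) 2 dxdy ℂ G‖ ^ 2 = 1 / N := by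
      have h1 : ContinuousMap.toLp (E := ℂ) 2 dxdy ℂ G =
          ∑ p ∈ T.image ι, c p • ContinuousMap.toLp (E := ℂ) 2 dxdy ℂ (tensorMode p) := by
        rw [hG, map_sum]
        simp_rw [map_smul]
      have h2 := horth.inner_sum c c (T.image ι)
      rw [← h1, inner_self_eq_norm_sq_to_K] at h2
      have h3 : ((‖ContinuousMap.toLp (E := ℂ) 2 dxdy ℂ G‖ ^ 2 : ℝ) : ℂ) = ((1 / N : ℝ) : ℂ) := by
        push_cast
        refine h2.trans ?_
        simp only [hc, Complex.conj_ofReal, Finset.sum_const, hcardS, nsmul_eq_mul]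
        push_cast
        field_simp
      exact_mod_cast h3
    have hle : ‖ContinuousMap.toLp (E := ℂ) 2 dxdy ℂ G‖ ≤ ε := by
      refine le_of_sq_le_sq ?_ hε.le
      rw [hGn]
      rw [div_lt_iff₀ (by positivity)] at hN
      rw [div_le_iff₀ hN0]
      linarith
    rw [Lp.norm_def, ← ENNReal.le_ofReal_iff_toReal_le (Lp.eLpNorm_ne_top _) hε.le,
      eLpNorm_congr_ae (ContinuousMap.coeFn_toLp dxdy G)] at hle
    refine le_trans (eLpNorm_mono fun z => ?_) hle
    have : trigPoly (T.image ι) c z = (G z).re := by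
      rw [trigPoly_apply, hG]
      simp
    rw [this]
    exact Complex.abs_re_le_norm _

/-! ### Integrable functions on the torus with square summable Fourier coefficients -/

/-- Uniqueness of Fourier coefficients for integrable functions: trigonometric polynomials are dense
among continuous functions, which in turn approximate indicators of closed sets. -/
theorem ae_eq_zero_of_integral_mFourier {h : T2 → ℂ} (hh : Integrable h dx)
    (h0 : ∀ n, ∫ x, mFourier n x * h x ∂dx = 0) : h =ᵐ[dx] 0 := by
  have hint : ∀ φ : C(T2, ℂ), Integrable (fun x => φ x * h x) dx := fun φ =>
    hh.bdd_mul (c := ‖φ‖) φ.continuous.aestronglyMeasurable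
      (ae_of_all _ fun x => φ.norm_coe_le_norm x)
  set L : C(T2, ℂ) →ₗ[ℂ] ℂ :=
    { toFun := fun φ => ∫ x, φ x * h x ∂dx
      map_add' := fun φ ψ => by
        simp only [ContinuousMap.add_apply, add_mul]
        exact integral_add (hint φ) (hint ψ)
      map_smul' := fun c φ => by
        simp only [ContinuousMap.smul_apply, smul_eq_mul, mul_assoc, RingHom.id_apply]
        exact integral_const_mul _ _ }
  have hL : ∀ φ, ‖L φ‖ ≤ (∫ x, ‖h x‖ ∂dx) * ‖φ‖ := fun φ => by
    rw [mul_comm, ← integral_const_mul]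
    refine (norm_integral_le_integral_norm _).trans
      (integral_mono (hint φ).norm (hh.norm.const_mul _) fun x => ?_)
    simp only [norm_mul]
    gcongr
    exact φ.norm_coe_le_norm x
  have hcont : ∀ φ : C(T2, ℂ), ∫ x, φ x * h x ∂dx = 0 := fun φ => by
    have hker : LinearMap.ker (L.mkContinuous _ hL).toLinearMap = ⊤ := by
      rw [eq_top_iff, ← span_mFourier_closure_eq_top (d := Fin 2)]
      refine Submodule.topologicalClosure_minimal _ (Submodule.span_le.2 ?_)
        (L.mkContinuous _ hL).isClosed_ker
      rintro _ ⟨n, rfl⟩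
      exact h0 n
    have : φ ∈ LinearMap.ker (L.mkContinuous _ hL).toLinearMap := by
      rw [hker]
      trivial
    exact this
  refine ae_eq_zero_of_forall_setIntegral_isClosed_eq_zero hh fun S hS => ?_
  rw [← integral_indicator hS.measurableSet]
  have hlim : Tendsto (fun k => ∫ x, ((hS.apprSeq k x : ℝ) : ℂ) * h x ∂dx) atTop
      (𝓝 (∫ x, S.indicator h x ∂dx)) := by
    refine tendsto_integral_of_dominated_convergence (fun x => ‖h x‖) (fun k => ?_) hh.norm
      (fun k => ae_of_all _ fun x => ?_) (ae_of_all _ fun x => ?_)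
    · refine AEStronglyMeasurable.mul ?_ hh.1
      have := (hS.apprSeq k).continuous
      exact Continuous.aestronglyMeasurable (by fun_prop)
    · rw [norm_mul, Complex.norm_real, Real.norm_of_nonneg (NNReal.coe_nonneg _)]
      refine mul_le_of_le_one_left (norm_nonneg _) ?_
      exact_mod_cast HasOuterApproxClosed.apprSeq_apply_le_one hS k x
    · have h1 := (tendsto_pi_nhds.1 (HasOuterApproxClosed.tendsto_apprSeq hS)) x
      have h2 := ((Complex.continuous_ofReal.comp NNReal.continuous_coe).tendsto _).comp h1
      have h3 := h2.mul_const (h x)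
      have h4 : S.indicator h x =
          (Complex.ofReal ∘ NNReal.toReal) (S.indicator (fun _ => 1) x) * h x := by
        by_cases hx : x ∈ S <;> simp [hx]
      rw [h4]
      exact h3
  refine tendsto_nhds_unique hlim ?_
  refine tendsto_const_nhds.congr fun k => (hcont ⟨fun x => ((hS.apprSeq k x : ℝ) : ℂ), ?_⟩).symm
  have := (hS.apprSeq k).continuous
  fun_prop

/-- The `L²` function with the same Fourier coefficients agrees with `h` almost everywhere. -/
theorem memLp_two_of_summable_coeff {h : T2 → ℂ} (hh : Integrable h dx)
    (hs : Summable fun n : Z2 => ‖∫ x, mFourier n x * h x ∂dx‖ ^ 2) : MemLp h 2 dx := by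
  set a : Z2 → ℂ := fun n => ∫ x, mFourier (-n) x * h x ∂dx with ha
  have ha2 : Memℓp a 2 := by
    refine memℓp_gen ?_
    simp only [ENNReal.toReal_ofNat, Real.rpow_ofNat]
    exact (Equiv.neg Z2).summable_iff.2 hs
  set g : Lp ℂ 2 (volume : Measure (UnitAddTorus (Fin 2))) := mFourierBasis.repr.symm ⟨a, ha2⟩
  have hg : ∀ n, ∫ x, mFourier (-n) x * g x ∂dx = a n := fun n => by
    have h1 := mFourierBasis_repr g n
    rw [LinearIsometryEquiv.apply_symm_apply] at h1
    exact h1.symm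
  have hgL : MemLp g 2 dx := Lp.memLp g
  have hgi : Integrable g dx := hgL.integrable one_le_two
  have hzero : (fun x => h x - g x) =ᵐ[dx] 0 := by
    refine ae_eq_zero_of_integral_mFourier (hh.sub hgi) fun n => ?_
    have hb : ∀ {u : T2 → ℂ}, Integrable u dx → Integrable (fun x => mFourier n x * u x) dx :=
      fun hu => hu.bdd_mul (c := 1) (mFourier n).continuous.aestronglyMeasurable
        (ae_of_all _ fun x => (norm_mFourier_apply n x).le)
    simp_rw [mul_sub]
    rw [integral_sub (hb hh) (hb hgi)]
    have := hg (-n)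
    simp only [ha, neg_neg] at this
    rw [this, sub_self]
  refine hgL.ae_eq ?_
  filter_upwards [hzero] with x hx
  exact (sub_eq_zero.1 hx).symm

end HaarVolume

/-! ### Summability of the Fourier coefficients of functions of class `H^{2+}` -/

theorem sqLen_nonneg (n : Z2) : 0 ≤ sqLen n := by
  unfold sqLen
  positivity

theorem sq_norm_le_sqLen (n : Z2) : ‖n‖ ^ 2 ≤ sqLen n := by
  have h : ‖n‖ ≤ Real.sqrt (sqLen n) := by
    refine (pi_norm_le_iff_of_nonneg (Real.sqrt_nonneg _)).2 fun i => ?_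
    rw [Int.norm_eq_abs]
    refine Real.abs_le_sqrt ?_
    unfold sqLen
    fin_cases i
    · exact le_add_of_nonneg_right (sq_nonneg _)
    · exact le_add_of_nonneg_left (sq_nonneg _)
  calc ‖n‖ ^ 2 ≤ Real.sqrt (sqLen n) ^ 2 := by gcongr
    _ = sqLen n := Real.sq_sqrt (sqLen_nonneg n)

theorem summable_one_add_sqLen_rpow {a : ℝ} (ha : 1 < a) :
    Summable fun n : Z2 => (1 + sqLen n) ^ (-a) := by
  refine Summable.of_norm_bounded_eventually
    (EisensteinSeries.summable_one_div_norm_rpow (k := 2 * a) (by linarith)) ?_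
  filter_upwards [(Set.finite_singleton (0 : Z2)).compl_mem_cofinite] with n hn
  have hn' : 0 < ‖n‖ := norm_pos_iff.2 hn
  have h1 : 0 < 1 + sqLen n := by linarith [sqLen_nonneg n]
  rw [Real.norm_of_nonneg (Real.rpow_nonneg h1.le _), neg_mul_eq_mul_neg, Real.rpow_mul hn'.le]
  refine Real.rpow_le_rpow_of_nonpos (by positivity) ?_ (by linarith)
  rw [Real.rpow_two]
  linarith [sq_norm_le_sqLen n]

/-- This is where the exponent `2 +` is needed: `T² × T²` has dimension four. -/
theorem IsH2Plus.summable_coeff₂ {f : T2 × T2 → ℝ} (hf : IsH2Plus f) : Summable (coeff₂ f) := by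
  obtain ⟨r, hr, hs⟩ := hf
  have hb : Summable fun n : Z2 => (1 + sqLen n) ^ (-(1 + r / 2)) :=
    summable_one_add_sqLen_rpow (by linarith)
  have hb2 : Summable fun p : Z2 × Z2 =>
      (1 + sqLen p.1) ^ (-(1 + r / 2)) * (1 + sqLen p.2) ^ (-(1 + r / 2)) :=
    hb.mul_of_nonneg hb (fun n => Real.rpow_nonneg (by linarith [sqLen_nonneg n]) _)
      (fun n => Real.rpow_nonneg (by linarith [sqLen_nonneg n]) _)
  refine Summable.of_norm_bounded (hs.add hb2) fun p => ?_
  have h1 := sqLen_nonneg p.1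
  have h2 := sqLen_nonneg p.2
  set W := 1 + sqLen p.1 + sqLen p.2 with hW
  have hW0 : 0 < W := by linarith
  have h3 : W ^ (-(2 + r)) ≤
      (1 + sqLen p.1) ^ (-(1 + r / 2)) * (1 + sqLen p.2) ^ (-(1 + r / 2)) := by
    have e : W ^ (-(2 + r)) = W ^ (-(1 + r / 2)) * W ^ (-(1 + r / 2)) := by
      rw [← Real.rpow_add hW0]
      congr 1
      ring
    rw [e]
    refine mul_le_mul (Real.rpow_le_rpow_of_nonpos (by linarith) (by linarith) (by linarith))
      (Real.rpow_le_rpow_of_nonpos (by linarith) (by linarith) (by linarith))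
      (Real.rpow_nonneg hW0.le _) (Real.rpow_nonneg (by linarith) _)
  refine le_trans ?_ (add_le_add_right h3 _)
  rw [Real.rpow_neg hW0.le]
  set V := W ^ (2 + r) with hV
  have hV0 : 0 < V := Real.rpow_pos_of_pos hW0 _
  have h4 : V * ‖coeff₂ f p‖ ^ 2 + V⁻¹ - 2 * ‖coeff₂ f p‖ = V⁻¹ * (V * ‖coeff₂ f p‖ - 1) ^ 2 := by
    field_simp
    ring
  have h5 : 0 ≤ V⁻¹ * (V * ‖coeff₂ f p‖ - 1) ^ 2 := by positivity
  linarith [norm_nonneg (coeff₂ f p)]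

/-! ### White noise in the Hartley basis -/

section WhiteNoise

variable {s : ℝ} {μ : Measure (Sobolev s)}

/-- The coordinates of white noise in the Hartley basis. -/
noncomputable def hartley (ω : Sobolev s) (n : Z2) : ℝ := ω.pair (casMode n)

theorem coeff_neg (ω : Distr) (n : Z2) : ω.coeff (-n) = (starRingEnd ℂ) (ω.coeff n) := by
  have h1 : cosMode (-n) = cosMode n := by
    refine Subtype.ext (funext fun x => ?_)
    simp [cosMode, mFourier_neg]
  have h2 : sinMode (-n) = -sinMode n := by
    refine Subtype.ext (funext fun x => ?_)
    simp [sinMode, mFourier_neg]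
  simp only [Distr.coeff, h1, h2, map_neg]
  rfl

theorem hartley_eq (ω : Sobolev s) (n : Z2) :
    hartley ω n = (ω.1.coeff n).re + (ω.1.coeff n).im := by
  simp only [hartley, Sobolev.pair, casMode, map_add, Distr.coeff]

/-- The inverse of `hartley_eq`: the cosine is even in the frequency and the sine is odd. -/
theorem coeff_eq_hartley (ω : Sobolev s) (n : Z2) :
    ω.1.coeff n = ⟨(hartley ω n + hartley ω (-n)) / 2, (hartley ω n - hartley ω (-n)) / 2⟩ := by
  apply Complex.ext <;> simp only [hartley_eq, coeff_neg, Complex.conj_re, Complex.conj_im] <;> ring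

theorem norm_coeff_sq (ω : Sobolev s) (n : Z2) :
    ‖ω.1.coeff n‖ ^ 2 = (hartley ω n ^ 2 + hartley ω (-n) ^ 2) / 2 := by
  rw [← Complex.normSq_eq_norm_sq, coeff_eq_hartley, Complex.normSq_mk]
  ring

theorem IsWhiteNoise.aemeasurable_pair (hμ : IsWhiteNoise μ) (φ : SmoothFun) :
    AEMeasurable (fun ω => ω.pair φ) μ :=
  aemeasurable_of_map_neZero (by rw [hμ φ]; infer_instance)

theorem IsWhiteNoise.isProbabilityMeasure (hμ : IsWhiteNoise μ) : IsProbabilityMeasure μ := by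
  have : IsProbabilityMeasure (μ.map fun ω => ω.pair 0) := by
    rw [hμ 0]
    infer_instance
  exact μ.isProbabilityMeasure_of_map fun ω => ω.pair 0

theorem IsWhiteNoise.aemeasurable_hartley (hμ : IsWhiteNoise μ) (n : Z2) :
    AEMeasurable (fun ω => hartley ω n) μ := hμ.aemeasurable_pair _

theorem IsWhiteNoise.aemeasurable_toLp_hartley (hμ : IsWhiteNoise μ) (S : Finset Z2) :
    AEMeasurable (fun ω => (WithLp.toLp 2 fun n : S => hartley ω n : EuclideanSpace ℝ S)) μ :=
  (WithLp.measurable_toLp 2 _).comp_aemeasurable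
    (aemeasurable_pi_lambda _ fun n => hμ.aemeasurable_hartley n)

theorem integral_sum_casMode_sq (S : Finset Z2) (t : S → ℝ) :
    ∫ x, (∑ n, t n * (casMode n).1 x) ^ 2 ∂dx = ∑ n, t n ^ 2 := by
  simp_rw [pow_two, Finset.sum_mul_sum]
  have hint : ∀ n m : S, Integrable
      (fun x => t n * (casMode n).1 x * (t m * (casMode m).1 x)) dx := fun n m =>
    integrable_of_continuous (((continuous_casMode n).const_mul _).mul
      ((continuous_casMode m).const_mul _))
  rw [integral_finsetSum _ fun n _ => integrable_finsetSum _ fun m _ => hint n m]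
  refine Finset.sum_congr rfl fun n _ => ?_
  rw [integral_finsetSum _ fun m _ => hint n m]
  have h : ∀ m : S, ∫ x, t n * (casMode n).1 x * (t m * (casMode m).1 x) ∂dx =
      if n = m then t n * t m else 0 := fun m => by
    have h1 : ∀ x, t n * (casMode n).1 x * (t m * (casMode m).1 x) =
        t n * t m * ((casMode n).1 x * (casMode m).1 x) := fun x => by ring
    simp_rw [h1]
    rw [integral_const_mul, integral_casMode_mul]
    simp only [Subtype.coe_inj, mul_ite, mul_one, mul_zero]
  simp_rw [h]
  simp

/-- The Hartley coordinates of white noise are independent standard Gaussian variables. -/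
theorem IsWhiteNoise.map_hartley (hμ : IsWhiteNoise μ) (S : Finset Z2) :
    μ.map (fun ω => (WithLp.toLp 2 fun n : S => hartley ω n : EuclideanSpace ℝ S)) =
      stdGaussian (EuclideanSpace ℝ S) := by
  have := hμ.isProbabilityMeasure
  have hm := hμ.aemeasurable_toLp_hartley S
  have := Measure.isProbabilityMeasure_map hm
  refine Measure.ext_of_charFun (funext fun t => ?_)
  rw [charFun_stdGaussian, charFun_apply, integral_map hm (by fun_prop)]
  set φ : SmoothFun := ∑ n : S, t n • casMode n with hφ
  have hpair : ∀ ω : Sobolev s, ω.pair φ = ∑ n : S, t n * hartley ω n := fun ω => by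
    simp only [hφ, Sobolev.pair, hartley, map_sum, map_smul, smul_eq_mul]
  have hφx : ∀ x, φ.1 x = ∑ n : S, t n * (casMode n).1 x := fun x => by
    simp [hφ]
  have h1 := congrFun (congrArg charFun (hμ φ)) 1
  rw [charFun_gaussianReal, charFun_apply, integral_map (hμ.aemeasurable_pair φ) (by fun_prop)] at h1
  simp_rw [hφx, integral_sum_casMode_sq] at h1
  rw [Real.coe_toNNReal _ (Finset.sum_nonneg fun _ _ => sq_nonneg _)] at h1
  have h2 : ∀ ω : Sobolev s,
      inner ℝ (WithLp.toLp 2 fun n : S => hartley ω n : EuclideanSpace ℝ S) t =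
        inner ℝ (ω.pair φ) (1 : ℝ) := fun ω => by
    rw [hpair]
    simp [PiLp.inner_apply]
  simp_rw [h2]
  rw [h1, ← Complex.ofReal_pow ‖t‖, EuclideanSpace.real_norm_sq_eq]
  congr 1
  push_cast
  ring

theorem IsWhiteNoise.map_hartley_apply (hμ : IsWhiteNoise μ) (n : Z2) :
    μ.map (fun ω => hartley ω n) = gaussianReal 0 1 := by
  have h := hμ (casMode n)
  simp only [pow_two, integral_casMode_mul, if_true, Real.toNNReal_one] at h
  exact h

/-- The dual pairing converges absolutely almost surely, as the coefficients of white noise have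
bounded second moments. -/
theorem IsWhiteNoise.ae_summable (hμ : IsWhiteNoise μ) {c : Z2 × Z2 → ℂ} (hc : Summable c) :
    ∀ᵐ ω ∂μ, Summable fun p => c p * (ω.1.coeff p.1 * ω.1.coeff p.2) := by
  have hm : ∀ n, AEMeasurable (fun ω : Sobolev s => ω.1.coeff n) μ := fun n => by
    simp_rw [coeff_eq_hartley]
    have h1 := hμ.aemeasurable_hartley n
    have h2 := hμ.aemeasurable_hartley (-n)
    have : AEMeasurable (fun ω : Sobolev s =>
        (((hartley ω n + hartley ω (-n)) / 2 : ℝ) : ℂ) +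
          (((hartley ω n - hartley ω (-n)) / 2 : ℝ) : ℂ) * Complex.I) μ := by
      fun_prop
    simpa [Complex.mk_eq_add_mul_I] using this
  set M : ENNReal := ∫⁻ x, ENNReal.ofReal (x ^ 2) ∂gaussianReal 0 1 with hM
  have hMtop : M ≠ ⊤ := by
    have h := (memLp_id_gaussianReal (μ := 0) (v := 1) 2).integrable_sq
    exact h.lintegral_lt_top.ne
  have hh : ∀ n, ∫⁻ ω, ENNReal.ofReal (hartley ω n ^ 2) ∂μ = M := fun n => by
    rw [hM, ← hμ.map_hartley_apply n, lintegral_map' (by fun_prop) (hμ.aemeasurable_hartley n)]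
  have hbound : ∀ p : Z2 × Z2, ∫⁻ ω, ‖c p * (ω.1.coeff p.1 * ω.1.coeff p.2)‖ₑ ∂μ ≤
      ‖c p‖ₑ * (M + M + (M + M)) := fun p => by
    simp_rw [enorm_mul (c p)]
    rw [lintegral_const_mul' _ _ enorm_ne_top]
    gcongr
    have hh' := fun n => (hμ.aemeasurable_hartley n)
    calc ∫⁻ ω, ‖ω.1.coeff p.1 * ω.1.coeff p.2‖ₑ ∂μ
        ≤ ∫⁻ ω, (ENNReal.ofReal (hartley ω p.1 ^ 2) + ENNReal.ofReal (hartley ω (-p.1) ^ 2)) +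
          (ENNReal.ofReal (hartley ω p.2 ^ 2) + ENNReal.ofReal (hartley ω (-p.2) ^ 2)) ∂μ := by
          refine lintegral_mono fun ω => ?_
          simp only
          rw [← ENNReal.ofReal_add (by positivity) (by positivity),
            ← ENNReal.ofReal_add (by positivity) (by positivity),
            ← ENNReal.ofReal_add (by positivity) (by positivity), ← ofReal_norm]
          apply ENNReal.ofReal_le_ofReal
          rw [norm_mul]
          have h1 := norm_coeff_sq ω p.1
          have h2 := norm_coeff_sq ω p.2
          nlinarith [sq_nonneg (‖ω.1.coeff p.1‖ - ‖ω.1.coeff p.2‖), sq_nonneg (‖ω.1.coeff p.1‖),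
            sq_nonneg (‖ω.1.coeff p.2‖)]
      _ = _ := by
          have hm2 : ∀ n, AEMeasurable (fun ω : Sobolev s => ENNReal.ofReal (hartley ω n ^ 2)) μ :=
            fun n => ((hh' n).pow_const 2).ennreal_ofReal
          rw [lintegral_add_left' (by fun_prop), lintegral_add_left' (hm2 _),
            lintegral_add_left' (hm2 _), hh, hh, hh, hh]
  have hfin : ∫⁻ ω, ∑' p, ‖c p * (ω.1.coeff p.1 * ω.1.coeff p.2)‖ₑ ∂μ ≠ ⊤ := by
    rw [lintegral_tsum fun p => ?_]
    · refine ne_top_of_le_ne_top ?_ (ENNReal.tsum_le_tsum hbound)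
      rw [ENNReal.tsum_mul_right]
      exact ENNReal.mul_ne_top (tsum_enorm_ne_top_iff_summable_norm.2 hc.norm) (by simp [hMtop])
    · exact (((hm p.1).mul (hm p.2)).const_mul _).enorm
  have hmeas : AEMeasurable
      (fun ω : Sobolev s => ∑' p, ‖c p * (ω.1.coeff p.1 * ω.1.coeff p.2)‖ₑ) μ :=
    AEMeasurable.tsum fun p => (((hm p.1).mul (hm p.2)).const_mul _).enorm
  filter_upwards [ae_lt_top' hmeas hfin] with ω hω
  exact (tsum_enorm_ne_top_iff_summable_norm.1 hω.ne).of_norm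

/-- The partial sums, over the frequencies in a box, of the quadratic form `⟨ω ⊗ ω, F⟩` minus its
mean. -/
noncomputable def chaosSum (F : T2 × T2 → ℝ) (N : ℕ) (ω : Sobolev s) : ℝ :=
  ∑ p ∈ box N ×ˢ box N, hartleyCoeff F p * (hartley ω p.1 * hartley ω p.2) -
    ∑ n ∈ box N, hartleyCoeff F (n, n)

theorem IsWhiteNoise.aemeasurable_chaosSum (hμ : IsWhiteNoise μ) (F : T2 × T2 → ℝ) (N : ℕ) :
    AEMeasurable (fun ω => chaosSum F N ω) μ := by
  unfold chaosSum
  refine AEMeasurable.sub_const (Finset.aemeasurable_fun_sum _ fun p _ => ?_) _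
  exact ((hμ.aemeasurable_hartley p.1).mul (hμ.aemeasurable_hartley p.2)).const_mul _

theorem IsWhiteNoise.lintegral_exp_chaosSum_le (hμ : IsWhiteNoise μ) (F : C(T2 × T2, ℝ)) {ε r : ℝ}
    (hr0 : 0 ≤ r) (hr : r < 1 / 2) (hF : ε ^ 2 * ∫ z, F z ^ 2 ∂dxdy ≤ r ^ 2) (N : ℕ) :
    ∫⁻ ω, ENNReal.ofReal (Real.exp (ε * chaosSum F N ω)) ∂μ ≤
      ENNReal.ofReal (Real.exp (2 * r ^ 2 / (1 - 2 * r))) := by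
  classical
  set A : Matrix (box N) (box N) ℝ := fun n m => ε * hartleyCoeff F (n, m) with hA
  have hA2 : ∑ n, ∑ m, A n m ^ 2 ≤ r ^ 2 := by
    refine le_trans (le_of_eq ?_) ((mul_le_mul_of_nonneg_left
      (sum_hartleyCoeff_sq_le F (box N ×ˢ box N)) (sq_nonneg ε)).trans hF)
    simp only [hA, mul_pow, ← Finset.mul_sum]
    rw [Finset.sum_product, ← Finset.sum_coe_sort (box N)]
    simp only [← Finset.sum_coe_sort (box N) fun m => hartleyCoeff F (_, m) ^ 2]
  have hm := hμ.aemeasurable_toLp_hartley (box N)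
  have h := lintegral_exp_quadratic_le A hr0 hr hA2
  rw [← hμ.map_hartley, lintegral_map' (by fun_prop) hm] at h
  refine le_trans (le_of_eq (lintegral_congr fun ω => ?_)) h
  congr 2
  simp only [hA, chaosSum, mul_sub, Finset.mul_sum]
  rw [Finset.sum_product, ← Finset.sum_coe_sort (box N)]
  simp only [← Finset.sum_coe_sort (box N), mul_assoc]

theorem tendsto_chaosSum (F : C(T2 × T2, ℝ)) (hF : Summable (coeff₂ F)) (ω : Sobolev s)
    (hω : Summable fun p => coeff₂ F p * (ω.1.coeff p.1 * ω.1.coeff p.2)) :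
    Tendsto (fun N => chaosSum F N ω) atTop
      (𝓝 (tensorPair F ω - ∫ x, F (x, x) ∂dx)) := by
  have hFi : Integrable F dxdy := integrable_of_continuous F.continuous
  refine Tendsto.sub ?_ ?_
  · have h1 := (hω.hasSum.comp tendsto_box)
    have h2 := (Complex.continuous_re.tendsto _).comp h1
    refine h2.congr fun N => ?_
    simp only [Function.comp_apply]
    rw [sum_coeff₂_eq_sum_hartleyCoeff (w := ω.1.coeff) neg_mem_box (coeff_neg ω.1) hFi,
      Complex.ofReal_re]
    simp only [hartley_eq]
  · -- the diagonal integral is the limit of the traces of the truncated matrices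
    have hint : ∀ p, Integrable (fun x => coeff₂ F p * tensorMode p (x, x)) dx := fun p =>
      integrable_of_continuous (by fun_prop)
    have h1 := hasSum_integral_of_summable_integral_norm hint (by
      simp only [norm_mul, norm_tensorMode_apply, mul_one]
      simpa using hF.norm)
    simp only [(hasSum_coeff₂ F hF (_, _)).tsum_eq, integral_complex_ofReal] at h1
    have h2 := (Complex.continuous_re.tendsto _).comp (h1.comp tendsto_box)
    rw [Complex.ofReal_re] at h2
    refine h2.congr fun N => ?_
    simp only [Function.comp_apply]
    rw [← integral_finsetSum _ fun p _ => hint p]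
    have h3 : ∀ x : T2, ∑ p ∈ box N ×ˢ box N, coeff₂ F p * tensorMode p (x, x) =
        ((∑ p ∈ box N ×ˢ box N,
          hartleyCoeff F p * ((casMode p.1).1 x * (casMode p.2).1 x) : ℝ) : ℂ) := fun x => by
      have := sum_coeff₂_eq_sum_hartleyCoeff (S := box N) (w := fun n => mFourier n x)
        neg_mem_box (fun n => mFourier_neg) hFi
      simpa only [tensorMode_apply, casMode_apply] using this
    simp_rw [h3]
    rw [integral_complex_ofReal, Complex.ofReal_re, integral_finsetSum _ fun p _ =>
      (integrable_of_continuous ((continuous_casMode p.1).mul (continuous_casMode p.2))).const_mul _]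
    simp_rw [integral_const_mul, integral_casMode_mul]
    rw [Finset.sum_product]
    simp

/-- The partial sums converge almost surely, so Fatou's lemma carries the bound for quadratic forms
in finitely many Gaussian variables over to `⟨ω ⊗ ω, F⟩`. -/
theorem IsWhiteNoise.lintegral_exp_tensorPair_le (hμ : IsWhiteNoise μ) (F : C(T2 × T2, ℝ))
    (hF : IsH2Plus F) {ε r : ℝ} (hr0 : 0 ≤ r) (hr : r < 1 / 2)
    (hFr : ε ^ 2 * ∫ z, F z ^ 2 ∂dxdy ≤ r ^ 2) :
    ∫⁻ ω, ENNReal.ofReal (Real.exp (ε * (tensorPair F ω - ∫ x, F (x, x) ∂dx))) ∂μ ≤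
      ENNReal.ofReal (Real.exp (2 * r ^ 2 / (1 - 2 * r))) := by
  have hlim : ∀ᵐ ω ∂μ, ENNReal.ofReal (Real.exp (ε * (tensorPair F ω - ∫ x, F (x, x) ∂dx))) =
      liminf (fun N => ENNReal.ofReal (Real.exp (ε * chaosSum F N ω))) atTop := by
    filter_upwards [hμ.ae_summable hF.summable_coeff₂] with ω hω
    refine (Tendsto.liminf_eq ?_).symm
    exact ((ENNReal.continuous_ofReal.comp Real.continuous_exp).tendsto _).comp
      ((tendsto_chaosSum F hF.summable_coeff₂ ω hω).const_mul ε)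
  rw [lintegral_congr_ae hlim]
  refine (lintegral_liminf_le' fun N => ?_).trans ?_
  · have := hμ.aemeasurable_chaosSum F N
    fun_prop
  · refine liminf_le_of_le (by isBoundedDefault) fun b hb => ?_
    obtain ⟨N, hN⟩ := hb.exists
    exact hN.trans (hμ.lintegral_exp_chaosSum_le F hr0 hr hFr N)

theorem IsWhiteNoise.aemeasurable_tensorPair (hμ : IsWhiteNoise μ) (F : C(T2 × T2, ℝ))
    (hF : IsH2Plus F) : AEMeasurable (fun ω => tensorPair F ω) μ := by
  have h : AEMeasurable (fun ω => tensorPair F ω - ∫ x, F (x, x) ∂dx) μ := by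
    refine aemeasurable_of_tendsto_metrizable_ae atTop (hμ.aemeasurable_chaosSum F) ?_
    filter_upwards [hμ.ae_summable hF.summable_coeff₂] with ω hω
    exact tendsto_chaosSum F hF.summable_coeff₂ ω hω
  simpa using h.add_const (∫ x, F (x, x) ∂dx)

end WhiteNoise

/-! ### The functional `⟨ω ⊗ ω, f⟩_c` of a square integrable kernel -/

theorem eLpNorm_two_sq_eq_lintegral {X : Type*} [MeasurableSpace X] (ν : Measure X) (f : X → ℝ) :
    eLpNorm f 2 ν ^ 2 = ∫⁻ x, ENNReal.ofReal (f x ^ 2) ∂ν := by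
  have h := eLpNorm_nnreal_pow_eq_lintegral (f := f) (μ := ν) (p := 2) two_ne_zero
  simp only [NNReal.coe_ofNat, ENNReal.coe_ofNat, ENNReal.rpow_ofNat] at h
  rw [h]
  refine lintegral_congr fun x => ?_
  rw [← sq_abs, ENNReal.ofReal_pow (abs_nonneg _), Real.enorm_eq_ofReal_abs]

theorem integral_sq_le_of_eLpNorm_le {F : C(T2 × T2, ℝ)} {t : ℝ} (ht : 0 ≤ t)
    (hF : eLpNorm F 2 dxdy ≤ ENNReal.ofReal t) : ∫ z, F z ^ 2 ∂dxdy ≤ t ^ 2 := by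
  have hi : Integrable (fun z => F z ^ 2) dxdy := integrable_of_continuous (by fun_prop)
  rw [← ENNReal.ofReal_le_ofReal_iff (by positivity),
    ofReal_integral_eq_lintegral_ofReal hi (ae_of_all _ fun z => sq_nonneg _),
    ← eLpNorm_two_sq_eq_lintegral, ENNReal.ofReal_pow ht]
  gcongr

theorem coeff₂_sub (F G : C(T2 × T2, ℝ)) (p : Z2 × Z2) :
    coeff₂ (F - G : C(T2 × T2, ℝ)) p = coeff₂ F p - coeff₂ G p := by
  have : F - G = F + (-1 : ℝ) • G := by
    rw [neg_one_smul, sub_eq_add_neg]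
  rw [this, coeff₂_add, coeff₂_smul]
  push_cast
  ring

theorem IsH2Plus.sub {F G : C(T2 × T2, ℝ)} (hF : IsH2Plus F) (hG : IsH2Plus G) :
    IsH2Plus (F - G : C(T2 × T2, ℝ)) := by
  obtain ⟨r, hr, hF⟩ := hF
  obtain ⟨r', hr', hG⟩ := hG
  refine ⟨min r r', lt_min hr hr', ?_⟩
  refine Summable.of_nonneg_of_le (fun p => ?_) (fun p => ?_) ((hF.mul_left 2).add (hG.mul_left 2))
  all_goals
    have h1 := sqLen_nonneg p.1
    have h2 := sqLen_nonneg p.2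
    have hW : 1 ≤ 1 + sqLen p.1 + sqLen p.2 := by linarith
    generalize 1 + sqLen p.1 + sqLen p.2 = W at hW
  · positivity
  · have e1 : W ^ (2 + min r r') ≤ W ^ (2 + r) :=
      Real.rpow_le_rpow_of_exponent_le hW (by linarith [min_le_left r r'])
    have e2 : W ^ (2 + min r r') ≤ W ^ (2 + r') :=
      Real.rpow_le_rpow_of_exponent_le hW (by linarith [min_le_right r r'])
    have e0 : 0 ≤ W ^ (2 + min r r') := by positivity
    rw [coeff₂_sub]
    have e3 : ‖coeff₂ F p - coeff₂ G p‖ ^ 2 ≤ 2 * ‖coeff₂ F p‖ ^ 2 + 2 * ‖coeff₂ G p‖ ^ 2 := by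
      have := norm_sub_le (coeff₂ F p) (coeff₂ G p)
      nlinarith [norm_nonneg (coeff₂ F p - coeff₂ G p), norm_nonneg (coeff₂ F p),
        norm_nonneg (coeff₂ G p), sq_nonneg (‖coeff₂ F p‖ - ‖coeff₂ G p‖)]
    calc W ^ (2 + min r r') * ‖coeff₂ F p - coeff₂ G p‖ ^ 2
        ≤ W ^ (2 + min r r') * (2 * ‖coeff₂ F p‖ ^ 2 + 2 * ‖coeff₂ G p‖ ^ 2) := by gcongr
      _ = 2 * (W ^ (2 + min r r') * ‖coeff₂ F p‖ ^ 2) +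
          2 * (W ^ (2 + min r r') * ‖coeff₂ G p‖ ^ 2) := by ring
      _ ≤ 2 * (W ^ (2 + r) * ‖coeff₂ F p‖ ^ 2) + 2 * (W ^ (2 + r') * ‖coeff₂ G p‖ ^ 2) := by
          gcongr

section Functional

variable {s : ℝ} {μ : Measure (Sobolev s)}

theorem IsWhiteNoise.lintegral_exp_abs_tensorPair_le (hμ : IsWhiteNoise μ) (F : C(T2 × T2, ℝ))
    (hF : IsH2Plus F) {ε r : ℝ} (hr0 : 0 ≤ r) (hr : r < 1 / 2)
    (hFr : ε ^ 2 * ∫ z, F z ^ 2 ∂dxdy ≤ r ^ 2) :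
    ∫⁻ ω, ENNReal.ofReal (Real.exp (ε * |tensorPair F ω - ∫ x, F (x, x) ∂dx|)) ∂μ ≤
      2 * ENNReal.ofReal (Real.exp (2 * r ^ 2 / (1 - 2 * r))) := by
  have hm := hμ.aemeasurable_tensorPair F hF
  calc ∫⁻ ω, ENNReal.ofReal (Real.exp (ε * |tensorPair F ω - ∫ x, F (x, x) ∂dx|)) ∂μ
      ≤ ∫⁻ ω, ENNReal.ofReal (Real.exp (ε * (tensorPair F ω - ∫ x, F (x, x) ∂dx))) +
        ENNReal.ofReal (Real.exp (-ε * (tensorPair F ω - ∫ x, F (x, x) ∂dx))) ∂μ := by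
        refine lintegral_mono fun ω => ?_
        rcases abs_choice (tensorPair F ω - ∫ x, F (x, x) ∂dx) with h | h
        · simp only [h]
          exact le_self_add
        · simp only [h, mul_neg, neg_mul]
          exact le_add_self
    _ ≤ ENNReal.ofReal (Real.exp (2 * r ^ 2 / (1 - 2 * r))) +
        ENNReal.ofReal (Real.exp (2 * r ^ 2 / (1 - 2 * r))) := by
        rw [lintegral_add_left' (by fun_prop)]
        exact add_le_add (hμ.lintegral_exp_tensorPair_le F hF hr0 hr hFr)
          (hμ.lintegral_exp_tensorPair_le F hF hr0 hr (by rwa [neg_sq]))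
    _ = _ := (two_mul _).symm

/-- The variance of `⟨ω ⊗ ω, F⟩` is bounded by a multiple of the squared `L²` norm of `F`. By
homogeneity this follows from the exponential bound for kernels of norm `1 / 4`. -/
theorem IsWhiteNoise.eLpNorm_tensorPair_sub_le (hμ : IsWhiteNoise μ) (F : C(T2 × T2, ℝ))
    (hF : IsH2Plus F) {t : ℝ} (ht : 0 < t) (hFt : eLpNorm F 2 dxdy ≤ ENNReal.ofReal t) :
    eLpNorm (fun ω => tensorPair F ω - ∫ x, F (x, x) ∂dx) 2 μ ≤
      ENNReal.ofReal (8 * Real.exp (1 / 8) * t) := by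
  have h1 := hμ.lintegral_exp_abs_tensorPair_le F hF (ε := 1 / (4 * t)) (r := 1 / 4)
    (by norm_num) (by norm_num) (by
      have := integral_sq_le_of_eLpNorm_le ht.le hFt
      calc (1 / (4 * t)) ^ 2 * ∫ z, F z ^ 2 ∂dxdy ≤ (1 / (4 * t)) ^ 2 * t ^ 2 := by gcongr
        _ = (1 / 4) ^ 2 := by field_simp)
  rw [← ENNReal.pow_le_pow_left_iff (two_ne_zero), eLpNorm_two_sq_eq_lintegral]
  calc ∫⁻ ω, ENNReal.ofReal ((tensorPair F ω - ∫ x, F (x, x) ∂dx) ^ 2) ∂μ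
      ≤ ∫⁻ ω, ENNReal.ofReal (32 * t ^ 2) * ENNReal.ofReal
          (Real.exp (1 / (4 * t) * |tensorPair F ω - ∫ x, F (x, x) ∂dx|)) ∂μ := by
        refine lintegral_mono fun ω => ?_
        simp only
        rw [← ENNReal.ofReal_mul (by positivity)]
        apply ENNReal.ofReal_le_ofReal
        generalize tensorPair F ω - ∫ x, F (x, x) ∂dx = y
        have h2 : 0 ≤ 1 / (4 * t) * |y| := by positivity
        have h3 := Real.quadratic_le_exp_of_nonneg h2
        have h4 : y ^ 2 = 32 * t ^ 2 * ((1 / (4 * t) * |y|) ^ 2 / 2) := by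
          rw [mul_pow, sq_abs]
          field_simp
          ring
        rw [h4]
        gcongr
        linarith
    _ ≤ ENNReal.ofReal (32 * t ^ 2) *
        (2 * ENNReal.ofReal (Real.exp (2 * (1 / 4) ^ 2 / (1 - 2 * (1 / 4))))) := by
        rw [lintegral_const_mul' _ _ ENNReal.ofReal_ne_top]
        gcongr
    _ = _ := by
        rw [← ENNReal.ofReal_ofNat 2, ← ENNReal.ofReal_mul (by norm_num),
          ← ENNReal.ofReal_mul (by positivity), ← ENNReal.ofReal_pow (by positivity)]
        congr 1
        rw [mul_pow, mul_pow, ← Real.exp_nat_mul]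
        norm_num
        ring

theorem IsWhiteNoise.eLpNorm_tensorPair_sub_tensorPair_le (hμ : IsWhiteNoise μ)
    {F G : C(T2 × T2, ℝ)} (hF : IsH2Plus F) (hG : IsH2Plus G) {t : ℝ} (ht : 0 < t)
    (hFG : eLpNorm (fun z => F z - G z) 2 dxdy ≤ ENNReal.ofReal t) :
    eLpNorm (fun ω => tensorPair F ω - tensorPair G ω) 2 μ ≤
      ENNReal.ofReal (8 * Real.exp (1 / 8) * t +
        |∫ x, F (x, x) ∂dx - ∫ x, G (x, x) ∂dx|) := by
  have := hμ.isProbabilityMeasure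
  have h1 := hμ.eLpNorm_tensorPair_sub_le (F - G) (hF.sub hG) ht hFG
  have hdiag : ∫ x, (F - G) (x, x) ∂dx = ∫ x, F (x, x) ∂dx - ∫ x, G (x, x) ∂dx := by
    rw [← integral_sub]
    · rfl
    · exact integrable_of_continuous (by fun_prop)
    · exact integrable_of_continuous (by fun_prop)
  have hae : (fun ω => tensorPair F ω - tensorPair G ω) =ᵐ[μ]
      (fun ω => tensorPair (F - G : C(T2 × T2, ℝ)) ω - ∫ x, (F - G) (x, x) ∂dx) +
        fun _ => ∫ x, F (x, x) ∂dx - ∫ x, G (x, x) ∂dx := by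
    filter_upwards [hμ.ae_summable hF.summable_coeff₂, hμ.ae_summable hG.summable_coeff₂]
      with ω h2 h3
    simp only [Pi.add_apply, hdiag, sub_add_cancel, tensorPair, coeff₂_sub, sub_mul]
    rw [h2.tsum_sub h3, Complex.sub_re]
  rw [eLpNorm_congr_ae hae, ENNReal.ofReal_add (by positivity) (abs_nonneg _)]
  refine (eLpNorm_add_le ?_ aestronglyMeasurable_const one_le_two).trans ?_
  · exact ((hμ.aemeasurable_tensorPair _ (hF.sub hG)).sub_const _).aestronglyMeasurable
  · gcongr
    rw [eLpNorm_const _ two_ne_zero (IsProbabilityMeasure.ne_zero μ)]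
    simp [Real.enorm_eq_ofReal_abs]

theorem IsWhiteNoise.memLp_tensorPair (hμ : IsWhiteNoise μ) {F : C(T2 × T2, ℝ)}
    (hF : IsH2Plus F) : MemLp (fun ω => tensorPair F ω) 2 μ := by
  have := hμ.isProbabilityMeasure
  have hFm : MemLp F 2 dxdy := F.memLp dxdy ℝ
  have h1 := hμ.eLpNorm_tensorPair_sub_le F hF (t := (eLpNorm F 2 dxdy).toReal + 1)
    (by positivity) (by
      rw [ENNReal.le_ofReal_iff_toReal_le hFm.eLpNorm_ne_top (by positivity)]
      linarith)
  have h2 : MemLp (fun ω => tensorPair F ω - ∫ x, F (x, x) ∂dx) 2 μ :=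
    ⟨((hμ.aemeasurable_tensorPair F hF).sub_const _).aestronglyMeasurable,
      h1.trans_lt ENNReal.ofReal_lt_top⟩
  simpa [Pi.add_def] using h2.add (memLp_const (∫ x, F (x, x) ∂dx))

/-- Approximation by trigonometric polynomials with prescribed diagonal integral: a correction that
is small in `L²` and concentrated near the diagonal adjusts the latter. -/
theorem exists_approx {f : T2 × T2 → ℝ} (hf : MemLp f 2 dxdy) (c : ℝ) {η : ℝ} (hη : 0 < η) :
    ∃ F : C(T2 × T2, ℝ), IsH2Plus F ∧ ∫ x, F (x, x) ∂dx = c ∧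
      eLpNorm (fun z => F z - f z) 2 dxdy ≤ ENNReal.ofReal η := by
  obtain ⟨s, b, hs⟩ := exists_trigPoly_eLpNorm_sub_le hf (half_pos hη)
  set P := trigPoly s b with hP
  set a := c - ∫ x, P (x, x) ∂dx with ha
  obtain ⟨s', b', h1, h2⟩ := exists_trigPoly_diagonal (ε := η / 2 / (|a| + 1)) (by positivity)
  set Q := trigPoly s' b' with hQ
  refine ⟨P + a • Q, isH2Plus_of_finite_support ?_, ?_, ?_⟩
  · refine ((finite_support_coeff₂_trigPoly s b).union
      (finite_support_coeff₂_trigPoly s' b')).subset fun p hp => ?_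
    contrapose! hp
    simp only [Set.mem_union, Function.mem_support, not_or, not_not] at hp ⊢
    rw [coeff₂_add, coeff₂_smul, hp.1, hp.2]
    simp
  · have hPQ : ∀ x, (P + a • Q) (x, x) = P (x, x) + a := fun x => by
      rw [ContinuousMap.add_apply, ContinuousMap.smul_apply, h1, smul_eq_mul, mul_one]
    simp_rw [hPQ]
    rw [integral_add (f := fun x : T2 => P (x, x)) (integrable_of_continuous (by fun_prop))
      (integrable_const _)]
    simp [ha]
  · have hsplit : (fun z => (P + a • Q) z - f z) = (fun z => P z - f z) + a • ⇑Q := by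
      funext z
      simp only [ContinuousMap.add_apply, ContinuousMap.smul_apply, Pi.add_apply, Pi.smul_apply]
      ring
    rw [hsplit]
    refine (eLpNorm_add_le (P.continuous.aestronglyMeasurable.sub hf.1)
      (Q.continuous.aestronglyMeasurable.const_smul a) one_le_two).trans ?_
    rw [eLpNorm_const_smul, ← add_halves η, ENNReal.ofReal_add (by positivity) (by positivity)]
    refine add_le_add hs ((mul_le_mul_right h2 _).trans ?_)
    rw [Real.enorm_eq_ofReal_abs, ← ENNReal.ofReal_mul (abs_nonneg _)]
    apply ENNReal.ofReal_le_ofReal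
    rw [mul_div_assoc', div_le_iff₀ (by positivity)]
    nlinarith [abs_nonneg a]

/-- The functionals of the approximating kernels form a Cauchy sequence in `L²(μ)`. -/
theorem IsWhiteNoise.exists_isTensorLimit (hμ : IsWhiteNoise μ) {f : T2 × T2 → ℝ}
    (hf : MemLp f 2 dxdy) (c : ℝ) : ∃ X, IsTensorLimit μ f c X := by
  have hη : ∀ k : ℕ, (0 : ℝ) < 1 / (k + 1) := fun k => by positivity
  choose F hF hdiag hFf using fun k : ℕ => exists_approx hf c (hη k)
  have hFf0 : Tendsto (fun k => eLpNorm (fun z => F k z - f z) 2 dxdy) atTop (𝓝 0) := by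
    refine tendsto_of_tendsto_of_tendsto_of_le_of_le tendsto_const_nhds ?_
      (fun _ => zero_le) hFf
    simpa using ENNReal.tendsto_ofReal tendsto_one_div_add_atTop_nhds_zero_nat
  set Y : ℕ → Lp ℝ 2 μ := fun k => (hμ.memLp_tensorPair (hF k)).toLp with hY
  set C := 8 * Real.exp (1 / 8) with hC
  have hC0 : 0 < C := by positivity
  have hcauchy : CauchySeq Y := by
    refine cauchySeq_of_le_tendsto_0 (fun N : ℕ => C * (1 / ((N : ℝ) + 1) + 1 / ((N : ℝ) + 1)))
      (fun n m N hn hm => ?_) ?_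
    · rw [dist_eq_norm, hY, ← MemLp.toLp_sub, Lp.norm_toLp]
      refine ENNReal.toReal_le_of_le_ofReal (by positivity) ?_
      have h1 : eLpNorm (fun z => F n z - F m z) 2 dxdy ≤
          ENNReal.ofReal (1 / ((N : ℝ) + 1) + 1 / ((N : ℝ) + 1)) := by
        have e : (fun z => F n z - F m z) = (fun z => F n z - f z) - fun z => F m z - f z := by
          funext z
          simp
        rw [e, ENNReal.ofReal_add (hη N).le (hη N).le]
        refine (eLpNorm_sub_le ((F n).continuous.aestronglyMeasurable.sub hf.1)
          ((F m).continuous.aestronglyMeasurable.sub hf.1) one_le_two).trans ?_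
        gcongr
        · exact (hFf n).trans (ENNReal.ofReal_le_ofReal (one_div_le_one_div_of_le (by positivity)
            (by exact_mod_cast Nat.succ_le_succ hn)))
        · exact (hFf m).trans (ENNReal.ofReal_le_ofReal (one_div_le_one_div_of_le (by positivity)
            (by exact_mod_cast Nat.succ_le_succ hm)))
      have h2 := hμ.eLpNorm_tensorPair_sub_tensorPair_le (hF n) (hF m)
        (add_pos (hη N) (hη N)) h1
      rw [hdiag, hdiag, sub_self, abs_zero, add_zero] at h2
      exact h2
    · have := (tendsto_one_div_add_atTop_nhds_zero_nat (𝕜 := ℝ))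
      simpa using (this.add this).const_mul C
  obtain ⟨X, hX⟩ := cauchySeq_tendsto_of_complete hcauchy
  refine ⟨X, Lp.memLp X, F, hF, hFf0, ?_, ?_⟩
  · simp_rw [hdiag]
    exact tendsto_const_nhds
  · rw [Lp.tendsto_Lp_iff_tendsto_eLpNorm'] at hX
    refine hX.congr fun k => eLpNorm_congr_ae ?_
    filter_upwards [(hμ.memLp_tensorPair (hF k)).coeFn_toLp] with ω hω
    simp only [hY, Pi.sub_apply, hω]

/-- Two approximating sequences have functionals with the same limit, since their difference tends to
zero in `L²` and so does the difference of their diagonal integrals. -/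
theorem IsWhiteNoise.isTensorLimit_unique (hμ : IsWhiteNoise μ) {f : T2 × T2 → ℝ}
    (hf : MemLp f 2 dxdy) {c : ℝ} {X X' : Sobolev s → ℝ} (hX : IsTensorLimit μ f c X)
    (hX' : IsTensorLimit μ f c X') : X =ᵐ[μ] X' := by
  obtain ⟨hXm, F, hF, hFf, hFc, hFX⟩ := hX
  obtain ⟨hXm', F', hF', hFf', hFc', hFX'⟩ := hX'
  set C := 8 * Real.exp (1 / 8) with hC
  set d : ℕ → ENNReal := fun k => eLpNorm (fun z => F k z - f z) 2 dxdy +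
    eLpNorm (fun z => F' k z - f z) 2 dxdy with hd
  have hd0 : Tendsto d atTop (𝓝 0) := by simpa using hFf.add hFf'
  have hdfin : ∀ k, d k ≠ ⊤ := fun k =>
    ENNReal.add_ne_top.2 ⟨(((F k).memLp dxdy ℝ).sub hf).eLpNorm_ne_top,
      (((F' k).memLp dxdy ℝ).sub hf).eLpNorm_ne_top⟩
  have hFF : ∀ k : ℕ, eLpNorm (fun ω => tensorPair (F k) ω - tensorPair (F' k) ω) 2 μ ≤
      ENNReal.ofReal (C * ((d k).toReal + 1 / (k + 1)) +
        |∫ x, F k (x, x) ∂dx - ∫ x, F' k (x, x) ∂dx|) := fun k => by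
    refine hμ.eLpNorm_tensorPair_sub_tensorPair_le (hF k) (hF' k) (by positivity) ?_
    have e : (fun z => F k z - F' k z) = (fun z => F k z - f z) - fun z => F' k z - f z := by
      funext z
      simp
    rw [e]
    refine (eLpNorm_sub_le ((F k).continuous.aestronglyMeasurable.sub hf.1)
      ((F' k).continuous.aestronglyMeasurable.sub hf.1) one_le_two).trans ?_
    change d k ≤ _
    rw [ENNReal.le_ofReal_iff_toReal_le (hdfin k) (by positivity)]
    have : (0 : ℝ) < 1 / (k + 1) := by positivity
    linarith
  have hlim : Tendsto (fun k : ℕ => ENNReal.ofReal (C * ((d k).toReal + 1 / (k + 1)) +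
        |∫ x, F k (x, x) ∂dx - ∫ x, F' k (x, x) ∂dx|)) atTop (𝓝 0) := by
    have h1 : Tendsto (fun k => (d k).toReal) atTop (𝓝 0) := by
      simpa [Function.comp_def] using (ENNReal.tendsto_toReal ENNReal.zero_ne_top).comp hd0
    have h2 := (h1.add (tendsto_one_div_add_atTop_nhds_zero_nat (𝕜 := ℝ))).const_mul C
    have h3 := h2.add (hFc.sub hFc').abs
    simpa using ENNReal.tendsto_ofReal h3
  have hbound : ∀ k, eLpNorm (X - X') 2 μ ≤
      eLpNorm (fun ω => tensorPair (F k) ω - X ω) 2 μ +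
      ENNReal.ofReal (C * ((d k).toReal + 1 / (k + 1)) +
        |∫ x, F k (x, x) ∂dx - ∫ x, F' k (x, x) ∂dx|) +
      eLpNorm (fun ω => tensorPair (F' k) ω - X' ω) 2 μ := fun k => by
    have hm := (hμ.memLp_tensorPair (hF k)).1
    have hm' := (hμ.memLp_tensorPair (hF' k)).1
    have e : X - X' = (((fun ω => tensorPair (F k) ω - tensorPair (F' k) ω) -
        fun ω => tensorPair (F k) ω - X ω)) + fun ω => tensorPair (F' k) ω - X' ω := by
      funext ω
      simp only [Pi.add_apply, Pi.sub_apply]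
      ring
    rw [e, add_comm (eLpNorm (fun ω => tensorPair (F k) ω - X ω) 2 μ)]
    refine (eLpNorm_add_le ((hm.sub hm').sub (hm.sub hXm.1)) (hm'.sub hXm'.1) one_le_two).trans ?_
    refine add_le_add ?_ le_rfl
    exact (eLpNorm_sub_le (hm.sub hm') (hm.sub hXm.1) one_le_two).trans (add_le_add (hFF k) le_rfl)
  have hzero : eLpNorm (X - X') 2 μ = 0 := by
    have hz := (hFX.add hlim).add hFX'
    rw [add_zero, add_zero] at hz
    exact le_antisymm (ge_of_tendsto' hz hbound) zero_le
  rw [eLpNorm_eq_zero_iff (hXm.1.sub hXm'.1) two_ne_zero] at hzero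
  filter_upwards [hzero] with ω hω
  exact sub_eq_zero.1 hω

/-- The exponential bound for the approximating functionals is uniform as soon as the `L²` norms of
`ε` times the kernels stay below a number less than `1 / 2`, and passes to the limit by Fatou's
lemma. -/
theorem IsWhiteNoise.integrable_exp (hμ : IsWhiteNoise μ) {f : T2 × T2 → ℝ}
    (hf : MemLp f 2 dxdy) {c : ℝ} {X : Sobolev s → ℝ} (hX : IsTensorLimit μ f c X) {M ε : ℝ}
    (hM : 0 ≤ M) (hfM : eLpNorm f 2 dxdy ≤ ENNReal.ofReal M) (hε : ε * M < 1 / 2) :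
    Integrable (fun ω => Real.exp (ε * |X ω|)) μ := by
  have := hμ.isProbabilityMeasure
  obtain ⟨hXm, F, hF, hFf, hFc, hFX⟩ := hX
  have hXae : AEMeasurable X μ := hXm.1.aemeasurable
  -- for `ε ≤ 0` the integrand is bounded
  rcases le_or_gt ε 0 with hε0 | hε0
  · refine Integrable.of_bound (by fun_prop) 1 (ae_of_all _ fun ω => ?_)
    rw [Real.norm_of_nonneg (Real.exp_pos _).le, Real.exp_le_one_iff]
    exact mul_nonpos_of_nonpos_of_nonneg hε0 (abs_nonneg _)
  obtain ⟨r, hr1, hr2⟩ := exists_between hε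
  have hr0 : 0 ≤ r := (mul_nonneg hε0.le hM).trans hr1.le
  have hMr : M < r / ε := by
    rw [lt_div_iff₀ hε0]
    linarith
  have hev : ∀ᶠ k in atTop, ε ^ 2 * ∫ z, F k z ^ 2 ∂dxdy ≤ r ^ 2 := by
    have h1 : ∀ᶠ k in atTop, eLpNorm (fun z => F k z - f z) 2 dxdy < ENNReal.ofReal (r / ε - M) :=
      hFf.eventually_lt_const (by simpa using hMr)
    filter_upwards [h1] with k hk
    have h2 : eLpNorm (F k) 2 dxdy ≤ ENNReal.ofReal (r / ε) := by
      have e : ⇑(F k) = (fun z => F k z - f z) + f := by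
        funext z
        simp
      rw [e]
      refine (eLpNorm_add_le ((F k).continuous.aestronglyMeasurable.sub hf.1) hf.1
        one_le_two).trans ((add_le_add hk.le hfM).trans ?_)
      rw [← ENNReal.ofReal_add (by linarith) hM, sub_add_cancel]
    calc ε ^ 2 * ∫ z, F k z ^ 2 ∂dxdy ≤ ε ^ 2 * (r / ε) ^ 2 := by
          gcongr
          exact integral_sq_le_of_eLpNorm_le (by positivity) h2
      _ = r ^ 2 := by field_simp
  -- convergence in mean square gives almost sure convergence along a subsequence
  obtain ⟨ns, hns, hae⟩ := (tendstoInMeasure_of_tendsto_eLpNorm two_ne_zero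
    (fun k => (hμ.memLp_tensorPair (hF k)).1) hXm.1 hFX).exists_seq_tendsto_ae
  have hlim : ∀ᵐ ω ∂μ, ENNReal.ofReal (Real.exp (ε * |X ω - c|)) =
      liminf (fun k => ENNReal.ofReal (Real.exp
        (ε * |tensorPair (F (ns k)) ω - ∫ x, F (ns k) (x, x) ∂dx|))) atTop := by
    filter_upwards [hae] with ω hω
    refine (Tendsto.liminf_eq ?_).symm
    exact ((ENNReal.continuous_ofReal.comp Real.continuous_exp).tendsto _).comp
      ((hω.sub (hFc.comp hns.tendsto_atTop)).abs.const_mul ε)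
  have hfin : ∫⁻ ω, ENNReal.ofReal (Real.exp (ε * |X ω - c|)) ∂μ < ⊤ := by
    rw [lintegral_congr_ae hlim]
    refine (lintegral_liminf_le' fun k => ?_).trans_lt (lt_of_le_of_lt ?_
      (ENNReal.mul_lt_top ENNReal.ofNat_lt_top ENNReal.ofReal_lt_top :
        2 * ENNReal.ofReal (Real.exp (2 * r ^ 2 / (1 - 2 * r))) < ⊤))
    · have := hμ.aemeasurable_tensorPair (F (ns k)) (hF (ns k))
      fun_prop
    · refine liminf_le_of_le (by isBoundedDefault) fun b hb => ?_
      obtain ⟨k, hk1, hk2⟩ := (hb.and (hns.tendsto_atTop.eventually hev)).exists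
      exact hk1.trans (hμ.lintegral_exp_abs_tensorPair_le _ (hF (ns k)) hr0 hr2 hk2)
  have hint : Integrable (fun ω => Real.exp (ε * |X ω - c|)) μ := by
    refine ⟨by fun_prop, ?_⟩
    rw [hasFiniteIntegral_iff_ofReal (ae_of_all _ fun ω => (Real.exp_pos _).le)]
    exact hfin
  refine (hint.const_mul (Real.exp (ε * |c|))).mono' (by fun_prop) (ae_of_all _ fun ω => ?_)
  rw [Real.norm_of_nonneg (Real.exp_pos _).le, ← Real.exp_add, Real.exp_le_exp, ← mul_add]
  have : |X ω| ≤ |c| + |X ω - c| := by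
    have := abs_add_le c (X ω - c)
    rwa [add_sub_cancel] at this
  gcongr

end Functional

/-! ### The Biot–Savart kernel -/

theorem hasDerivAt_mFourier_single (n : Z2) (i : Fin 2) (x : T2) :
    HasDerivAt (fun t : ℝ => mFourier n (x + Pi.single i (t : UnitAddCircle)))
      (2 * Real.pi * Complex.I * n i * mFourier n x) 0 := by
  have h1 : ∀ t : ℝ, mFourier n (x + Pi.single i (t : UnitAddCircle)) =
      mFourier n x * fourier (n i) (t : UnitAddCircle) := fun t => by
    fin_cases i <;> simp [mFourier, fourier_apply, smul_add, AddCircle.toCircle_add] <;> ring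
  simp_rw [h1]
  have h2 := (hasDerivAt_fourier 1 (n i) 0).const_mul (mFourier n x)
  refine h2.congr_deriv ?_
  simp
  ring

theorem pd_cosMode (n : Z2) (i : Fin 2) (x : T2) :
    pd i (cosMode n).1 x = (2 * Real.pi * Complex.I * n i * mFourier n x).re :=
  (Complex.reCLM.hasFDerivAt.comp_hasDerivAt 0 (hasDerivAt_mFourier_single n i x)).deriv

theorem pd_sinMode (n : Z2) (i : Fin 2) (x : T2) :
    pd i (sinMode n).1 x = (2 * Real.pi * Complex.I * n i * mFourier n x).im :=
  (Complex.imCLM.hasFDerivAt.comp_hasDerivAt 0 (hasDerivAt_mFourier_single n i x)).deriv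

/-- The integral `∫ e_n K_i`, that is, the Fourier coefficient of `K_i` at the frequency `-n`. -/
noncomputable def kernelCoeff (K : T2 → Fin 2 → ℝ) (i : Fin 2) (n : Z2) : ℂ :=
  ∫ x, mFourier n x * (K x i : ℂ) ∂dx

theorem integrable_mFourier_mul {u : T2 → ℝ} (hu : Integrable u dx) (n : Z2) :
    Integrable (fun x => mFourier n x * (u x : ℂ)) dx :=
  hu.ofReal.bdd_mul (c := 1) (mFourier n).continuous.aestronglyMeasurable
    (ae_of_all _ fun x => (norm_mFourier_apply n x).le)

theorem IsBiotSavart.integral_combination {K : T2 → Fin 2 → ℝ} (hK : IsBiotSavart K) (n : Z2)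
    (a b : ℂ) :
    ∫ x, (a * mFourier n x * (K x 0 : ℂ) + b * mFourier n x * (K x 1 : ℂ)) ∂dx =
      a * kernelCoeff K 0 n + b * kernelCoeff K 1 n := by
  simp_rw [mul_assoc]
  rw [integral_add ((integrable_mFourier_mul (hK.integrable 0) n).const_mul a)
    ((integrable_mFourier_mul (hK.integrable 1) n).const_mul b), integral_const_mul,
    integral_const_mul]
  rfl

theorem IsBiotSavart.integrable_combination {K : T2 → Fin 2 → ℝ} (hK : IsBiotSavart K) (n : Z2)
    (a b : ℂ) :
    Integrable (fun x => a * mFourier n x * (K x 0 : ℂ) + b * mFourier n x * (K x 1 : ℂ)) dx := by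
  simp_rw [mul_assoc]
  exact ((integrable_mFourier_mul (hK.integrable 0) n).const_mul a).add
    ((integrable_mFourier_mul (hK.integrable 1) n).const_mul b)

/-- The equation `div K = 0` tested against the real and imaginary parts of `eₙ`. -/
theorem IsBiotSavart.div_coeff {K : T2 → Fin 2 → ℝ} (hK : IsBiotSavart K) (n : Z2) :
    n 0 * kernelCoeff K 0 n + n 1 * kernelCoeff K 1 n = 0 := by
  set a : ℂ := 2 * Real.pi * Complex.I * n 0 with ha
  set b : ℂ := 2 * Real.pi * Complex.I * n 1 with hb
  have hi := hK.integrable_combination n a b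
  have h : a * kernelCoeff K 0 n + b * kernelCoeff K 1 n = 0 := by
    rw [← hK.integral_combination]
    apply Complex.ext
    · have h1 := integral_re hi
      simp only [RCLike.re_eq_complex_re] at h1
      rw [← h1, Complex.zero_re, ← hK.div_eq (cosMode n)]
      refine integral_congr_ae (ae_of_all _ fun x => ?_)
      simp only [pd_cosMode, Complex.add_re, Complex.re_mul_ofReal, ha, hb]
      ring
    · have h1 := integral_im hi
      simp only [RCLike.im_eq_complex_im] at h1
      rw [← h1, Complex.zero_im, ← hK.div_eq (sinMode n)]
      refine integral_congr_ae (ae_of_all _ fun x => ?_)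
      simp only [pd_sinMode, Complex.add_im, Complex.im_mul_ofReal, ha, hb]
      ring
  have h2 : (2 * Real.pi * Complex.I : ℂ) * (n 0 * kernelCoeff K 0 n + n 1 * kernelCoeff K 1 n) =
      0 := by
    rw [← h, ha, hb]
    ring
  exact (mul_eq_zero.1 h2).resolve_left Complex.two_pi_I_ne_zero

/-- The vorticity equation tested against the real and imaginary parts of `eₙ`, for `n ≠ 0`. -/
theorem IsBiotSavart.curl_coeff {K : T2 → Fin 2 → ℝ} (hK : IsBiotSavart K) {n : Z2} (hn : n ≠ 0) :
    n 1 * kernelCoeff K 0 n - n 0 * kernelCoeff K 1 n = -(2 * Real.pi * Complex.I)⁻¹ := by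
  set a : ℂ := 2 * Real.pi * Complex.I * n 1 with ha
  set b : ℂ := -(2 * Real.pi * Complex.I * n 0) with hb
  have hi := hK.integrable_combination n a b
  have hone : mFourier n (0 : T2) = 1 := by simp [mFourier]
  have hmean := integral_mFourier n
  rw [if_neg hn] at hmean
  have hmi : Integrable (fun x => mFourier n x) dx :=
    integrable_of_continuous (mFourier n).continuous
  have h : a * kernelCoeff K 0 n + b * kernelCoeff K 1 n = -1 := by
    rw [← hK.integral_combination]
    apply Complex.ext
    · have h1 := integral_re hi
      have h2 := integral_re hmi
      simp only [RCLike.re_eq_complex_re] at h1 h2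
      have h3 := hK.curl_eq (cosMode n)
      have h4 : ∫ x, (cosMode n).1 x ∂dx = 0 := h2.trans (by rw [hmean]; rfl)
      have h5 : (cosMode n).1 0 = 1 := by simp [cosMode, hone]
      rw [h4, h5, sub_zero, neg_eq_iff_eq_neg] at h3
      rw [← h1, Complex.neg_re, Complex.one_re]
      refine (integral_congr_ae (ae_of_all _ fun x => ?_)).trans h3
      simp only [pd_cosMode, Complex.add_re, Complex.re_mul_ofReal, ha, hb, neg_mul,
        Complex.neg_re]
      ring
    · have h1 := integral_im hi
      have h2 := integral_im hmi
      simp only [RCLike.im_eq_complex_im] at h1 h2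
      have h3 := hK.curl_eq (sinMode n)
      have h4 : ∫ x, (sinMode n).1 x ∂dx = 0 := h2.trans (by rw [hmean]; rfl)
      have h5 : (sinMode n).1 0 = 0 := by simp [sinMode, hone]
      rw [h4, h5, sub_zero, neg_eq_iff_eq_neg] at h3
      rw [← h1, Complex.neg_im, Complex.one_im]
      refine (integral_congr_ae (ae_of_all _ fun x => ?_)).trans h3
      simp only [pd_sinMode, Complex.add_im, Complex.im_mul_ofReal, ha, hb, neg_mul,
        Complex.neg_im]
      ring
  have h2 : (2 * Real.pi * Complex.I : ℂ) * (n 1 * kernelCoeff K 0 n - n 0 * kernelCoeff K 1 n) =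
      -1 := by
    rw [← h, ha, hb]
    ring
  rw [← inv_mul_cancel_left₀ Complex.two_pi_I_ne_zero
    (n 1 * kernelCoeff K 0 n - n 0 * kernelCoeff K 1 n), h2]
  ring

/-- The Fourier coefficients of `K` are those of the perpendicular gradient of the Green function:
a multiple of `n^⊥ / |n|²`. -/
theorem IsBiotSavart.kernelCoeff_eq {K : T2 → Fin 2 → ℝ} (hK : IsBiotSavart K) {n : Z2}
    (hn : n ≠ 0) :
    kernelCoeff K 0 n = -(2 * Real.pi * Complex.I)⁻¹ * ((n 1 / sqLen n : ℝ) : ℂ) ∧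
    kernelCoeff K 1 n = (2 * Real.pi * Complex.I)⁻¹ * ((n 0 / sqLen n : ℝ) : ℂ) := by
  have h1 := hK.div_coeff n
  have h2 := hK.curl_coeff hn
  have h0 : (0 : ℝ) < sqLen n :=
    lt_of_lt_of_le (by have := norm_pos_iff.2 hn; positivity) (sq_norm_le_sqLen n)
  have h0' : ((sqLen n : ℝ) : ℂ) ≠ 0 := by exact_mod_cast h0.ne'
  have hs : ((sqLen n : ℝ) : ℂ) = (n 0 : ℂ) ^ 2 + (n 1 : ℂ) ^ 2 := by
    simp [sqLen]
  generalize (2 * Real.pi * Complex.I : ℂ)⁻¹ = w at *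
  constructor
  · apply mul_right_cancel₀ h0'
    push_cast
    rw [mul_assoc, div_mul_cancel₀ _ h0', hs]
    linear_combination (n 0 : ℂ) * h1 + (n 1 : ℂ) * h2
  · apply mul_right_cancel₀ h0'
    push_cast
    rw [mul_assoc, div_mul_cancel₀ _ h0', hs]
    linear_combination (n 1 : ℂ) * h1 - (n 0 : ℂ) * h2

/-- The inversion `n ↦ n / |n|²` of the plane satisfies
`|n/|n|² - m/|m|²|² = |n - m|² / (|n|² |m|²)`. -/
theorem inversion_sub_sq {p p' q q' : ℝ} (hA : p ^ 2 + p' ^ 2 ≠ 0) (hB : q ^ 2 + q' ^ 2 ≠ 0) :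
    (p / (p ^ 2 + p' ^ 2) - q / (q ^ 2 + q' ^ 2)) ^ 2 +
      (p' / (p ^ 2 + p' ^ 2) - q' / (q ^ 2 + q' ^ 2)) ^ 2 =
    ((p - q) ^ 2 + (p' - q') ^ 2) / ((p ^ 2 + p' ^ 2) * (q ^ 2 + q' ^ 2)) := by
  field_simp
  ring

theorem one_le_sqLen {n : Z2} (hn : n ≠ 0) : 1 ≤ sqLen n := by
  have h : (1 : ℝ) ≤ ‖n‖ := by
    obtain ⟨i, hi⟩ := Function.ne_iff.1 hn
    refine le_trans ?_ (norm_le_pi_norm n i)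
    rw [Int.norm_eq_abs]
    exact_mod_cast Int.one_le_abs hi
  nlinarith [sq_norm_le_sqLen n]

theorem IsBiotSavart.norm_kernelCoeff_sub_sq_le {K : T2 → Fin 2 → ℝ} (hK : IsBiotSavart K)
    (i j : Fin 2) {n : Z2} (hn : n ≠ 0) (hn' : n + Pi.single j 1 ≠ 0) :
    ‖kernelCoeff K i (n + Pi.single j 1) - kernelCoeff K i n‖ ^ 2 ≤
      ‖(2 * Real.pi * Complex.I : ℂ)⁻¹‖ ^ 2 * (16 * (1 + sqLen n) ^ (-2 : ℝ)) := by
  set m : Z2 := n + Pi.single j 1 with hm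
  have hA := one_le_sqLen hn'
  have hB := one_le_sqLen hn
  have hdiff : ((m 0 : ℝ) - n 0) ^ 2 + ((m 1 : ℝ) - n 1) ^ 2 = 1 := by
    fin_cases j <;> simp [hm]
  have hid := inversion_sub_sq (p := m 0) (p' := m 1) (q := n 0) (q' := n 1)
    (ne_of_gt (lt_of_lt_of_le one_pos hA)) (ne_of_gt (lt_of_lt_of_le one_pos hB))
  rw [hdiff] at hid
  change ((m 0 : ℝ) / sqLen m - n 0 / sqLen n) ^ 2 + ((m 1 : ℝ) / sqLen m - n 1 / sqLen n) ^ 2 =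
    1 / (sqLen m * sqLen n) at hid
  -- `|n| ≤ |m| + 1 ≤ 2 |m|`
  have hBA : sqLen n ≤ 4 * sqLen m := by
    have : sqLen n ≤ 2 * sqLen m + 2 * (((m 0 : ℝ) - n 0) ^ 2 + ((m 1 : ℝ) - n 1) ^ 2) := by
      unfold sqLen
      nlinarith [sq_nonneg ((m 0 : ℝ) + (m 0 - n 0)), sq_nonneg ((m 1 : ℝ) + (m 1 - n 1))]
    rw [hdiff] at this
    linarith
  have hfin : 1 / (sqLen m * sqLen n) ≤ 16 * (1 + sqLen n) ^ (-2 : ℝ) := by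
    rw [Real.rpow_neg (by linarith), Real.rpow_two, ← div_eq_mul_inv,
      div_le_div_iff₀ (by positivity) (by positivity)]
    nlinarith
  have key : ∀ w : ℂ, ∀ a b : ℝ, (a - b) ^ 2 ≤ 1 / (sqLen m * sqLen n) →
      ‖w * (a : ℂ) - w * (b : ℂ)‖ ^ 2 ≤ ‖w‖ ^ 2 * (16 * (1 + sqLen n) ^ (-2 : ℝ)) :=
    fun w a b hab => by
      rw [← mul_sub, norm_mul, mul_pow, ← Complex.ofReal_sub, Complex.norm_real, Real.norm_eq_abs,
        sq_abs]
      gcongr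
      exact hab.trans hfin
  have hmk := hK.kernelCoeff_eq hn'
  have hnk := hK.kernelCoeff_eq hn
  fin_cases i
  · simp only [Fin.zero_eta]
    rw [hmk.1, hnk.1, ← norm_neg (2 * Real.pi * Complex.I : ℂ)⁻¹]
    exact key _ _ _ (by nlinarith [sq_nonneg ((m 0 : ℝ) / sqLen m - n 0 / sqLen n)])
  · simp only [Fin.mk_one]
    rw [hmk.2, hnk.2]
    exact key _ _ _ (by nlinarith [sq_nonneg ((m 1 : ℝ) / sqLen m - n 1 / sqLen n)])

/-- Although `K` itself is not square integrable, its product with a function vanishing at the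
origin is: multiplication by `e_j - 1` takes differences of the Fourier coefficients. -/
theorem IsBiotSavart.memLp_mul {K : T2 → Fin 2 → ℝ} (hK : IsBiotSavart K) (i j : Fin 2) :
    MemLp (fun x => (mFourier (Pi.single j 1) x - 1) * (K x i : ℂ)) 2 dx := by
  have hi := fun n => integrable_mFourier_mul (hK.integrable i) n
  have hint : Integrable (fun x => (mFourier (Pi.single j 1) x - 1) * (K x i : ℂ)) dx := by
    simp_rw [sub_mul, one_mul]
    exact (hi _).sub (hK.integrable i).ofReal
  refine memLp_two_of_summable_coeff hint ?_
  have hcoeff : ∀ n : Z2, ∫ x, mFourier n x * ((mFourier (Pi.single j 1) x - 1) * (K x i : ℂ)) ∂dx =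
      kernelCoeff K i (n + Pi.single j 1) - kernelCoeff K i n := fun n => by
    rw [kernelCoeff, kernelCoeff, ← integral_sub (hi _) (hi _)]
    refine integral_congr_ae (ae_of_all _ fun x => ?_)
    simp only [mFourier_add]
    ring
  simp_rw [hcoeff]
  refine Summable.of_norm_bounded_eventually
    (((summable_one_add_sqLen_rpow one_lt_two).mul_left 16).mul_left
      (‖(2 * Real.pi * Complex.I : ℂ)⁻¹‖ ^ 2)) ?_
  -- the coefficient of `K` at the frequency zero is exceptional: it enters for `n = 0` and for
  -- `n = -e_j`
  filter_upwards [(Set.finite_singleton (0 : Z2)).compl_mem_cofinite,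
    (Set.finite_singleton (-Pi.single j 1 : Z2)).compl_mem_cofinite] with n h1 h2
  rw [Real.norm_of_nonneg (sq_nonneg _)]
  exact hK.norm_kernelCoeff_sub_sq_le i j h1 fun h => h2 (eq_neg_of_add_eq_zero_left h)

/-! ### The symmetrised kernel `H_φ` is square integrable -/

/-- On the fundamental domain around the origin, the distance to `0` is controlled by
`|exp (2πit) - 1|`. -/
theorem abs_le_norm_mFourier_sub_one {d : Fin 2 → ℝ} (hd : ∀ j, |d j| ≤ 1 / 2) (j : Fin 2) :
    |d j| ≤ ‖mFourier (Pi.single j 1) (fun i => (d i : UnitAddCircle)) - 1‖ := by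
  have h1 : mFourier (Pi.single j 1) (fun i => (d i : UnitAddCircle)) =
      Complex.exp (Complex.I * ((2 * Real.pi * d j : ℝ) : ℂ)) := by
    rw [mFourier_single, fourier_coe_apply]
    congr 1
    push_cast
    simp
    ring
  rw [h1, Complex.norm_exp_I_mul_ofReal_sub_one, norm_mul, Real.norm_eq_abs, Real.norm_eq_abs,
    abs_two]
  have hpi := Real.pi_pos
  have h2 : |Real.sin (2 * Real.pi * d j / 2)| = Real.sin (Real.pi * |d j|) := by
    have e : 2 * Real.pi * d j / 2 = Real.pi * d j := by ring
    have hs : 0 ≤ Real.sin (Real.pi * |d j|) :=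
      Real.sin_nonneg_of_nonneg_of_le_pi (by positivity) (by nlinarith [hd j])
    rw [e]
    rcases abs_choice (d j) with h | h
    · rw [h] at hs ⊢
      exact abs_of_nonneg hs
    · rw [h] at hs ⊢
      rw [mul_neg, Real.sin_neg] at hs ⊢
      exact abs_of_nonpos (by linarith)
  have h3 := Real.mul_le_sin (x := Real.pi * |d j|) (by positivity) (by nlinarith [hd j])
  have h4 : 2 / Real.pi * (Real.pi * |d j|) = 2 * |d j| := by field_simp
  rw [h2]
  linarith [abs_nonneg (d j)]

theorem pd_coe (φ : SmoothFun) (i : Fin 2) (x : Fin 2 → ℝ) :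
    pd i φ.1 (fun k => (x k : UnitAddCircle)) = fderiv ℝ (lift φ.1) x (Pi.single i 1) := by
  have h1 : ∀ t : ℝ, φ.1 ((fun k => (x k : UnitAddCircle)) + Pi.single i (t : UnitAddCircle)) =
      lift φ.1 (x + t • Pi.single i 1) := fun t => by
    refine congrArg φ.1 (funext fun k => ?_)
    fin_cases i <;> fin_cases k <;> simp
  have hφ : ContDiff ℝ (⊤ : ℕ∞) (lift φ.1) := φ.2
  have hd : HasFDerivAt (lift φ.1) (fderiv ℝ (lift φ.1) x) x :=
    (hφ.differentiable (by simp) x).hasFDerivAt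
  have h2 : HasDerivAt (fun t : ℝ => x + t • (Pi.single i 1 : Fin 2 → ℝ)) (Pi.single i 1) 0 := by
    simpa using ((hasDerivAt_id (0 : ℝ)).smul_const (Pi.single i 1 : Fin 2 → ℝ)).const_add x
  unfold pd
  simp_rw [h1]
  have h3 : HasFDerivAt (lift φ.1) (fderiv ℝ (lift φ.1) x)
      (x + (0 : ℝ) • (Pi.single i 1 : Fin 2 → ℝ)) := by simpa using hd
  exact (h3.comp_hasDerivAt 0 h2).deriv

/-- The partial derivatives of a smooth function are Lipschitz on the torus. -/
theorem exists_abs_pd_sub_le (φ : SmoothFun) (i : Fin 2) : ∃ C : ℝ, 0 ≤ C ∧ ∀ x y : T2,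
    |pd i φ.1 x - pd i φ.1 y| ≤ C * ∑ j, ‖mFourier (Pi.single j 1) (x - y) - 1‖ := by
  have hφ : ContDiff ℝ (⊤ : ℕ∞) (lift φ.1) := φ.2
  set G : (Fin 2 → ℝ) → ℝ := fun x => fderiv ℝ (lift φ.1) x (Pi.single i 1) with hG
  have hGc : ContDiff ℝ 1 G := ((contDiff_infty.1 hφ 2).fderiv_right (m := 1) le_rfl).clm_apply
    contDiff_const
  set Q : Set (Fin 2 → ℝ) := Set.Icc (fun _ => -1) (fun _ => 2) with hQ
  obtain ⟨C, hC⟩ := (isCompact_Icc : IsCompact Q).exists_bound_of_continuousOn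
    (hGc.continuous_fderiv one_ne_zero).continuousOn
  have hlip : ∀ a ∈ Q, ∀ b ∈ Q, ‖G a - G b‖ ≤ C * ‖a - b‖ := fun a ha b hb =>
    (convex_Icc _ _).norm_image_sub_le_of_norm_fderiv_le
      (fun x _ => hGc.differentiable one_ne_zero x) hC hb ha
  refine ⟨|C|, abs_nonneg C, fun x y => ?_⟩
  -- representatives of `y` and of `x - y`
  set b : Fin 2 → ℝ := fun k => (AddCircle.equivIco 1 0 (y k) : ℝ) with hb
  set d : Fin 2 → ℝ := fun k => (AddCircle.equivIco 1 (-(1 / 2)) (x k - y k) : ℝ) with hd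
  have hb1 : ∀ k, 0 ≤ b k ∧ b k < 1 := fun k => by
    simpa using (AddCircle.equivIco (1 : ℝ) 0 (y k)).2
  have hd1 : ∀ k, |d k| ≤ 1 / 2 := fun k => by
    have := (AddCircle.equivIco (1 : ℝ) (-(1 / 2)) (x k - y k)).2
    rw [Set.mem_Ico] at this
    exact abs_le.2 ⟨this.1, by linarith [this.2]⟩
  have hby : y = fun k => (b k : UnitAddCircle) := funext fun k => AddCircle.coe_equivIco.symm
  have hdxy : x - y = fun k => (d k : UnitAddCircle) := funext fun k => AddCircle.coe_equivIco.symm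
  have hx : x = fun k => ((b + d) k : UnitAddCircle) := by
    rw [← sub_add_cancel x y, hdxy]
    nth_rw 1 [hby]
    funext k
    simp [add_comm]
  have hbQ : b ∈ Q := Set.mem_Icc.2 ⟨fun k => by linarith [(hb1 k).1], fun k => by
    linarith [(hb1 k).2]⟩
  have hbdQ : b + d ∈ Q := Set.mem_Icc.2 ⟨fun k => by
    have := (abs_le.1 (hd1 k)).1
    simp only [Pi.add_apply]
    linarith [(hb1 k).1], fun k => by
    have := (abs_le.1 (hd1 k)).2
    simp only [Pi.add_apply]
    linarith [(hb1 k).2]⟩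
  have h1 := hlip _ hbdQ _ hbQ
  rw [add_sub_cancel_left] at h1
  have e1 : pd i φ.1 x = G (b + d) := by rw [hx, pd_coe]
  have e2 : pd i φ.1 y = G b := by
    conv_lhs => rw [hby]
    rw [pd_coe]
  rw [e1, e2, hdxy]
  refine h1.trans ((mul_le_mul_of_nonneg_right (le_abs_self C) (norm_nonneg d)).trans ?_)
  gcongr
  refine (pi_norm_le_iff_of_nonneg (Finset.sum_nonneg fun _ _ => norm_nonneg _)).2 fun j => ?_
  rw [Real.norm_eq_abs]
  exact (abs_le_norm_mFourier_sub_one hd1 j).trans (Finset.single_le_sum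
    (f := fun j => ‖mFourier (Pi.single j 1) (fun i => (d i : UnitAddCircle)) - 1‖)
    (fun _ _ => norm_nonneg _) (Finset.mem_univ j))

theorem continuous_pd (φ : SmoothFun) (i : Fin 2) : Continuous (pd i φ.1) := by
  obtain ⟨C, -, hC⟩ := exists_abs_pd_sub_le φ i
  refine continuous_iff_continuousAt.2 fun y => ?_
  refine tendsto_iff_dist_tendsto_zero.2 (squeeze_zero (fun _ => dist_nonneg) (fun x => hC x y) ?_)
  have hc : Continuous fun x : T2 => C * ∑ j, ‖mFourier (Pi.single j 1) (x - y) - 1‖ := by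
    fun_prop
  have h := hc.tendsto y
  have h0 : ∀ j : Fin 2, mFourier (Pi.single j 1) (0 : T2) = 1 := fun j => by
    simp [mFourier_single]
  simpa [h0] using h

theorem measurePreserving_sub : MeasurePreserving (fun z : T2 × T2 => z.1 - z.2) dxdy dx :=
  measurePreserving_fst.comp (measurePreserving_sub_prod dx dx)

/-- The singularity of `K` on the diagonal is compensated by the Lipschitz continuity of `∇φ`. -/
theorem IsBiotSavart.memLp_kerH {K : T2 → Fin 2 → ℝ} (hK : IsBiotSavart K) (φ : SmoothFun) :
    MemLp (kerH K φ.1) 2 dxdy := by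
  suffices h : ∀ i ∈ (Finset.univ : Finset (Fin 2)), MemLp
      (fun z : T2 × T2 => K (z.1 - z.2) i * (pd i φ.1 z.1 - pd i φ.1 z.2)) 2 dxdy from
    (memLp_finsetSum Finset.univ h).const_mul (1 / 2)
  intro i _
  obtain ⟨C, hC0, hC⟩ := exists_abs_pd_sub_le φ i
  have hm : AEStronglyMeasurable (fun z : T2 × T2 => K (z.1 - z.2) i) dxdy :=
    (hK.integrable i).1.comp_measurePreserving measurePreserving_sub
  have hp : Continuous fun z : T2 × T2 => pd i φ.1 z.1 - pd i φ.1 z.2 :=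
    ((continuous_pd φ i).comp continuous_fst).sub ((continuous_pd φ i).comp continuous_snd)
  have hj : ∀ j ∈ (Finset.univ : Finset (Fin 2)), MemLp (fun z : T2 × T2 =>
      ‖(mFourier (Pi.single j 1) (z.1 - z.2) - 1) * (K (z.1 - z.2) i : ℂ)‖) 2 dxdy := fun j _ =>
    ((hK.memLp_mul i j).comp_measurePreserving measurePreserving_sub).norm
  have hdom := (memLp_finsetSum Finset.univ hj).const_mul C
  refine hdom.mono' (hm.mul hp.aestronglyMeasurable) (ae_of_all _ fun z => ?_)
  simp only [norm_mul, Complex.norm_real, ← Finset.sum_mul]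
  rw [mul_comm, ← mul_assoc]
  gcongr
  exact hC z.1 z.2

theorem eLpNorm_two_le_of_ae_bound {f : T2 × T2 → ℝ} {M : ℝ} (hf : ∀ᵐ z ∂dxdy, |f z| ≤ M) :
    eLpNorm f 2 dxdy ≤ ENNReal.ofReal M := by
  have h : ∀ᵐ z ∂dxdy, ‖f z‖ ≤ M := hf
  simpa using eLpNorm_le_of_ae_bound (p := 2) h

end Enstrophy

theorem theorem3 (δ : ℝ) (hδ : 0 < δ)
    (μ : MeasureTheory.Measure (Enstrophy.Sobolev (-1 - δ))) (hμ : Enstrophy.IsWhiteNoise μ) :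
    -- the functional of a bounded measurable kernel
    (∀ f : Enstrophy.T2 × Enstrophy.T2 → ℝ, Measurable f →
      (∀ᵐ z ∂Enstrophy.dxdy, |f z| ≤ 1) → ∀ c : ℝ,
        (∃ X, Enstrophy.IsTensorLimit μ f c X) ∧
        (∀ X X', Enstrophy.IsTensorLimit μ f c X → Enstrophy.IsTensorLimit μ f c X' →
          X =ᵐ[μ] X') ∧
        ∀ X, Enstrophy.IsTensorLimit μ f c X → ∀ ε : ℝ, ε < 1 / 2 →
          MeasureTheory.Integrable (fun ω => Real.exp (ε * |X ω|)) μ) ∧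
    -- the nonlinear term of the Euler equations
    (∀ K : Enstrophy.T2 → Fin 2 → ℝ, Enstrophy.IsBiotSavart K → ∀ φ : Enstrophy.SmoothFun,
        (∃ Y, Enstrophy.IsNonlinearTerm μ K φ Y) ∧
        (∀ Y Y', Enstrophy.IsNonlinearTerm μ K φ Y → Enstrophy.IsNonlinearTerm μ K φ Y' →
          Y =ᵐ[μ] Y') ∧
        (∃ ε : ℝ, 0 < ε ∧ ∀ Y, Enstrophy.IsNonlinearTerm μ K φ Y →
          MeasureTheory.Integrable (fun ω => Real.exp (ε * |Y ω|)) μ) ∧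
        ∀ M : ℝ, (∀ᵐ z ∂Enstrophy.dxdy, |Enstrophy.kerH K φ.1 z| ≤ M) →
          ∀ ε : ℝ, ε * M < 1 / 2 → ∀ Y, Enstrophy.IsNonlinearTerm μ K φ Y →
            MeasureTheory.Integrable (fun ω => Real.exp (ε * |Y ω|)) μ) := by
  refine ⟨fun f hf hf1 c => ?_, fun K hK φ => ?_⟩
  · have hfL : MemLp f 2 Enstrophy.dxdy := MemLp.of_bound hf.aestronglyMeasurable 1 hf1
    refine ⟨hμ.exists_isTensorLimit hfL c, fun X X' => hμ.isTensorLimit_unique hfL,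
      fun X hX ε hε => ?_⟩
    exact hμ.integrable_exp hfL hX zero_le_one (Enstrophy.eLpNorm_two_le_of_ae_bound hf1)
      (by linarith)
  · have hL := hK.memLp_kerH φ
    refine ⟨hμ.exists_isTensorLimit hL 0, fun Y Y' => hμ.isTensorLimit_unique hL, ?_,
      fun M hM ε hε Y hY => ?_⟩
    · set ρ := (eLpNorm (Enstrophy.kerH K φ.1) 2 Enstrophy.dxdy).toReal with hρ
      have hρ0 : 0 ≤ ρ := ENNReal.toReal_nonneg
      refine ⟨1 / (4 * (ρ + 1)), by positivity, fun Y hY => ?_⟩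
      refine hμ.integrable_exp hL hY hρ0 (ENNReal.ofReal_toReal hL.eLpNorm_ne_top).ge ?_
      rw [one_div_mul_eq_div, div_lt_iff₀ (by positivity)]
      linarith
    · have hM0 : 0 ≤ M := by
        obtain ⟨z, hz⟩ := hM.exists
        exact (abs_nonneg _).trans hz
      exact hμ.integrable_exp hL hY hM0 (Enstrophy.eLpNorm_two_le_of_ae_bound hM) hε
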